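/- Let $\mathbb{S}^n$ be the space of real symmetric $n\times n$ matrices with the Frobenius inner product $\langle\cdot,\cdot\rangle$ and norm $\|\cdot\|$, let $\mathbb{S}^n_+\subset\mathbb{S}^n$ be the cone of positive semidefinite matrices and $\mathbb{N}^n$ the cone of entrywise nonnegative matrices. Write $\Pi_C$ for the metric projection onto a closed convex set $C$. For a map $F:\mathbb{S}^n\to\mathbb{S}^n$, let $\partial F(X)$ denote Clarke's generalized Jacobian, i.e. the convex hull of all limits $\lim_k F'(X_k)$ with $X_k\to X$ and $F$ Fréchet differentiable at each $X_k$. Let $G,\widetilde S,\widetilde Z\in\mathbb{S}^n$ and $\sigma>0$, and consider the augmented Lagrangian subproblem of minimizing over $X\in\mathbb{S}^n$ the function $$\tilde f(X)=\tfrac12\|X-G\|^2+\tfrac1{2\sigma}\Big(\|\Pi_{\mathbb{S}^n_+}(\widetilde S-\sigma X)\|^2+\|\Pi_{\mathbb{N}^n}(\widetilde Z-\sigma X)\|^2\Big).$$ Algorithm SNCG. Let $\mu\in(0,1/2)$, $\eta\in(0,1)$, $\tau\in(0,1]$, $\delta\in(0,1)$ and $X^0\in\mathbb{S}^n$. For $j=0,1,2,\dots$: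 1. Choose any $V_1^j\in\partial\Pi_{\mathbb{S}^n_+}(\widetilde S-\sigma X^j)$ and $V_2^j\in\partial\Pi_{\mathbb{N}^n}(\widetilde Z-\sigma X^j)$ (with both projections regarded as maps $\mathbb{S}^n\to\mathbb{S}^n$). Apply the conjugate gradient method, started at $0$, to the linear system $(I+\sigma V_1^j+\sigma V_2^j)\Delta X=-\nabla\tilde f(X^j)$, and let $\Delta X_j$ be its first iterate with $$\|(I+\sigma V_1^j+\sigma V_2^j)\Delta X_j+\nabla\tilde f(X^j)\|\le\min\big(\eta,\ \|\nabla\tilde f(X^j)\|^{1+\tau}\big).$$ 2. Set $\alpha_j=\delta^{m_j}$, where $m_j$ is the smallest nonnegative integer $m$ with $\tilde f(X^j+\delta^m\Delta X_j)\le\tilde f(X^j)+\mu\delta^m\langle\nabla\tilde f(X^j),\Delta X_j\rangle$. 3. Set $X^{j+1}=X^j+\alpha_j\Delta X_j$. Proposition. Let $\{X^j\}$ be an infinite sequence generated by Algorithm SNCG. Then $\tilde f$ has a unique minimizer $\overline X$ over $\mathbb{S}^n$, the sequence $\{X^j\}$ converges to $\overline X$, and $$\|X^{j+1}-\overline X\|=O\big(\|X^j-\overline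 X\|^{1+\tau}\big)\qquad(j\to\infty).$$ -/

import Mathlib

open Filter Topology
open scoped RealInnerProductSpace Gradient

namespace DNN

noncomputable section

/-! ### Symmetric matrices with the Frobenius inner product -/

/-- The real symmetric `n × n` matrices, as a subspace of the Euclidean space `ℝ^{n × n}`. -/
def symSubmodule (n : ℕ) : Submodule ℝ (EuclideanSpace ℝ (Fin n × Fin n)) where
  carrier := {A | ∀ i j, A (i, j) = A (j, i)}
  add_mem' := by
    intro A B hA hB i j
    simp [hA i j, hB i j]
  zero_mem' := by
    intro i j
    simp
  smul_mem' := by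
    intro c A hA i j
    simp [hA i j]

/-- The space `𝕊ⁿ` of real symmetric matrices. Its norm and inner product are inherited from
`ℝ^{n × n}`, hence are the Frobenius ones. -/
abbrev SymMat (n : ℕ) : Type := symSubmodule n

variable {n : ℕ}

/-- The underlying matrix of an element of `𝕊ⁿ`. -/
def SymMat.toMatrix (A : SymMat n) : Matrix (Fin n) (Fin n) ℝ :=
  Matrix.of fun i j => A.1 (i, j)

theorem SymMat.toMatrix_isSymm (A : SymMat n) : A.toMatrix.IsSymm := by
  ext i j
  exact A.2 j i

theorem SymMat.inner_eq_trace (A B : SymMat n) :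
    ⟪A, B⟫ = (A.toMatrix.transpose * B.toMatrix).trace := by
  simp only [Submodule.coe_inner, PiLp.inner_apply, Matrix.trace, Matrix.diag, Matrix.mul_apply,
    Fintype.sum_prod_type, SymMat.toMatrix, Matrix.transpose_apply, Matrix.of_apply]
  rw [Finset.sum_comm]
  simp [mul_comm]

/-- The cone `𝕊ⁿ₊` of positive semidefinite matrices. -/
def psdCone (n : ℕ) : Set (SymMat n) := {A | A.toMatrix.PosSemidef}

/-- The cone of entrywise nonnegative (symmetric) matrices. -/
def nonnegCone (n : ℕ) : Set (SymMat n) := {A | ∀ i j, 0 ≤ A.toMatrix i j}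

/-! ### Metric projection and Clarke's generalized Jacobian -/

/-- The metric projection of `x` onto `C`: a point of `C` nearest to `x`
(it exists and is unique when `C` is nonempty, closed and convex). -/
def metricProj {E : Type*} [NormedAddCommGroup E] (C : Set E) (x : E) : E :=
  Classical.epsilon fun y => y ∈ C ∧ ∀ z ∈ C, ‖x - y‖ ≤ ‖x - z‖

/-- The B-subdifferential: limits of Jacobians at points of differentiability tending to `x`. -/
def bSubdiff {E : Type*} [NormedAddCommGroup E] [NormedSpace ℝ E] (F : E → E) (x : E) :
    Set (E →L[ℝ] E) :=
  {V | ∃ u : ℕ → E, Tendsto u atTop (𝓝 x) ∧ (∀ k, DifferentiableAt ℝ F (u k)) ∧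
    Tendsto (fun k => fderiv ℝ F (u k)) atTop (𝓝 V)}

/-- Clarke's generalized Jacobian: the convex hull of the B-subdifferential. -/
def clarkeJacobian {E : Type*} [NormedAddCommGroup E] [NormedSpace ℝ E] (F : E → E) (x : E) :
    Set (E →L[ℝ] E) :=
  convexHull ℝ (bSubdiff F x)

/-! ### The augmented Lagrangian -/

/-- The augmented Lagrangian of the projection problem
`min { ½‖X - G‖² | X ∈ 𝕊ⁿ₊, X entrywise nonnegative }` with penalty parameter `σ`. -/
def augLagrangian (G : SymMat n) (σ : ℝ) (S Z X : SymMat n) : ℝ :=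
  1 / 2 * ‖X - G‖ ^ 2 +
    1 / (2 * σ) * (‖metricProj (psdCone n) (S - σ • X)‖ ^ 2 +
      ‖metricProj (nonnegCone n) (Z - σ • X)‖ ^ 2)

/-! ### The conjugate gradient method -/

/-- The state of the conjugate gradient method: iterate, residual and search direction. -/
structure CGState (E : Type*) where
  x : E
  r : E
  p : E

/-- The `k`-th state of the conjugate gradient method for `A x = b` started at `x = 0`. After
`r = 0` has been reached the iterate no longer changes (`0 / 0 = 0`). -/
def cgState {E : Type*} [NormedAddCommGroup E] [InnerProductSpace ℝ E] (A : E →L[ℝ] E) (b : E) :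
    ℕ → CGState E
  | 0 => ⟨0, b, b⟩
  | k + 1 =>
    let s := cgState A b k
    let a : ℝ := ⟪s.r, s.r⟫ / ⟪s.p, A s.p⟫
    let r' := s.r - a • A s.p
    let β : ℝ := ⟪r', r'⟫ / ⟪s.r, s.r⟫
    ⟨s.x + a • s.p, r', r' + β • s.p⟩

/-- `d` is what the conjugate gradient method for `A x = b` (started at `0`) returns when it is
stopped at its first iterate `x` with `‖A x - b‖ ≤ tol`. -/
def IsCGOutput {E : Type*} [NormedAddCommGroup E] [InnerProductSpace ℝ E] (A : E →L[ℝ] E) (b : E)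
    (tol : ℝ) (d : E) : Prop :=
  ∃ k, IsLeast {k : ℕ | ‖A (cgState A b k).x - b‖ ≤ tol} k ∧ d = (cgState A b k).x

/-! ### The semismooth Newton-CG method -/

/-- `X'` is a possible successor of the iterate `X` in the semismooth Newton-CG method with line
search, with parameters `μ η τ δ`, for minimizing `f = L_σ(·; S, Z)`. -/
def IsSNCGStep (G S Z : SymMat n) (σ μ η τ δ : ℝ) (X X' : SymMat n) : Prop :=
  let f : SymMat n → ℝ := augLagrangian G σ S Z
  ∃ V₁ ∈ clarkeJacobian (metricProj (psdCone n)) (S - σ • X),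
  ∃ V₂ ∈ clarkeJacobian (metricProj (nonnegCone n)) (Z - σ • X),
  ∃ D : SymMat n,
    IsCGOutput (ContinuousLinearMap.id ℝ (SymMat n) + σ • V₁ + σ • V₂) (-∇ f X)
      (min η (‖∇ f X‖ ^ (1 + τ))) D ∧
    ∃ m : ℕ,
      IsLeast {m : ℕ | f (X + δ ^ m • D) ≤ f X + μ * δ ^ m * ⟪∇ f X, D⟫} m ∧
      X' = X + δ ^ m • D

/-- The sequence `X` is generated by the semismooth Newton-CG method with line search
(from an arbitrary starting point `X 0`). -/
def IsSNCGSequence (G S Z : SymMat n) (σ μ η τ δ : ℝ) (X : ℕ → SymMat n) : Prop :=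
  ∀ j, IsSNCGStep G S Z σ μ η τ δ (X j) (X (j + 1))

end

end DNN

/-! Write `f` for the augmented Lagrangian, `g` for its gradient and `P` for either projection.
Since `P` is the gradient of `½‖P ·‖²`, the elements of its Clarke Jacobian are symmetric, positive
semidefinite and of norm at most 1. Hence `f` is strongly convex with modulus 1, `g` is Lipschitz,
and every Newton matrix `A` satisfies `‖v‖² ≤ ⟪A v, v⟫`.

Global convergence. A conjugate gradient iterate satisfies the Galerkin identity `⟪-g, d⟫ = ⟪A d,
d⟫`, so `d` is a descent direction with `‖d‖² ≤ -⟪g, d⟫`. The tolerance is at most a fixed fraction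
`θ < 1` of `‖g‖`, which bounds `‖d‖` below by a multiple of `‖g‖`, and backtracking steps stay
bounded away from 0. Each step therefore lowers `f` by at least `c‖g‖²`. As `f ≥ 0`, the gradients
tend to 0, and strong monotonicity of `g` makes the iterates Cauchy.

Local rate. Put `h = ‖x - z‖` with `z` the limit. Strong semismoothness, `g x - g z - A (x - z) =
O(h²)`, gives `‖x + d - z‖ = O(h^(1+τ))`. The unit step is accepted because the trapezoidal rule `f
x - f z = ½⟪g x + g z, x - z⟫ + O(h³)` yields `f (x + d) - f x ≤ ½⟪g x, d⟫ + o(h²)`, while `-⟪g x,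
d⟫ ≥ h²/4` and `μ < 1/2`.

Both estimates are local statements about the projections. For the nonnegative cone they are exact,
since signs of nonzero entries are locally constant. For the semidefinite cone, with `N = P - id`,
both come from the matrix equation `P(Y) N(Y) = 0`, expanded around `X` for the trapezoidal rule
(`psdProj_trapezoid`) and differentiated at `Y` for semismoothness (`psdProj_quadratic_estimate`).
-/

namespace DNN

/-- The map `P` satisfies the variational characterisation of the metric projection onto a closed
convex cone: the range of `P` plays the role of the cone. -/
structure IsConeProj {E : Type*} [NormedAddCommGroup E] [InnerProductSpace ℝ E] (P : E → E) :
    Prop where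
  inner_self : ∀ x, ⟪x - P x, P x⟫ = 0
  inner_le : ∀ x y, ⟪x - P x, P y⟫ ≤ 0

/-! ### Metric projections onto cones and their derivatives. -/

section ConeProj

variable {E : Type*} [NormedAddCommGroup E] [InnerProductSpace ℝ E]

/-- The obtuse-angle inequality gives `‖x - z‖² ≥ ‖x - y‖² + ‖z - y‖²` on `C`, so `y` is the only
nearest point and the choice operator must return it. -/
theorem metricProj_eq_of_inner_le {C : Set E} {x y : E} (hy : y ∈ C)
    (h : ∀ z ∈ C, ⟪x - y, z - y⟫ ≤ 0) : metricProj C x = y := by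
  have hex : ∃ y, y ∈ C ∧ ∀ z ∈ C, ‖x - y‖ ≤ ‖x - z‖ := by
    refine ⟨y, hy, fun z hz => ?_⟩
    have h1 := h z hz
    have h2 : ‖x - z‖ ^ 2 = ‖x - y‖ ^ 2 - 2 * ⟪x - y, z - y⟫ + ‖z - y‖ ^ 2 := by
      rw [← norm_sub_sq_real]; congr 2; abel
    exact le_of_sq_le_sq (by nlinarith [sq_nonneg ‖z - y‖]) (norm_nonneg _)
  have hs := Classical.epsilon_spec hex
  change metricProj C x ∈ C ∧ ∀ z ∈ C, ‖x - metricProj C x‖ ≤ ‖x - z‖ at hs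
  set w := metricProj C x
  have h1 := h w hs.1
  have h2 : ‖x - w‖ ^ 2 = ‖x - y‖ ^ 2 - 2 * ⟪x - y, w - y⟫ + ‖w - y‖ ^ 2 := by
    rw [← norm_sub_sq_real]; congr 2; abel
  have h3 := pow_le_pow_left₀ (norm_nonneg _) (hs.2 y hy) 2
  have h4 : ‖w - y‖ ^ 2 = 0 := le_antisymm (by linarith) (sq_nonneg _)
  exact sub_eq_zero.1 (norm_eq_zero.1 (pow_eq_zero_iff (two_ne_zero) |>.1 h4))

/-- For a cone, an orthogonality and a polarity condition identify the metric projection. -/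
theorem metricProj_eq_of_polar {C : Set E} {x y : E} (hy : y ∈ C) (h0 : ⟪x - y, y⟫ = 0)
    (h : ∀ z ∈ C, ⟪x - y, z⟫ ≤ 0) : metricProj C x = y :=
  metricProj_eq_of_inner_le hy fun z hz => by
    rw [inner_sub_right, h0, sub_zero]; exact h z hz

namespace IsConeProj

variable {P : E → E} (hP : IsConeProj P)
include hP

theorem norm_sq_le_inner (x y : E) : ‖P x - P y‖ ^ 2 ≤ ⟪x - y, P x - P y⟫ := by
  have h1 := hP.inner_self x
  have h2 := hP.inner_self y
  have h3 := hP.inner_le x y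
  have h4 := hP.inner_le y x
  rw [← real_inner_self_eq_norm_sq]
  simp only [inner_sub_left, inner_sub_right] at *
  linarith [real_inner_comm (P x) (P y)]

theorem norm_sub_le (x y : E) : ‖P x - P y‖ ≤ ‖x - y‖ := by
  have h1 := hP.norm_sq_le_inner x y
  have h2 := real_inner_le_norm (x - y) (P x - P y)
  by_contra! h
  nlinarith [norm_nonneg (x - y)]

theorem map_smul {t : ℝ} (ht : 0 < t) (x : E) : P (t • x) = t • P x := by
  have h1 := hP.inner_self x
  have h2 := hP.inner_self (t • x)
  have h3 := hP.inner_le x (t • x)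
  have h4 := hP.inner_le (t • x) x
  have h5 : ‖P (t • x) - t • P x‖ ^ 2 ≤ 0 := by
    rw [← real_inner_self_eq_norm_sq]
    simp only [inner_sub_left, inner_sub_right, inner_smul_left, inner_smul_right,
      RCLike.conj_to_real] at *
    rw [real_inner_comm (P x) (P (t • x))] at *
    have e1 := mul_le_mul_of_nonneg_left h3 ht.le
    have e2 := mul_le_mul_of_nonneg_left h4 ht.le
    have e3 : t * (t * (⟪x, P x⟫ - ⟪P x, P x⟫)) = 0 := by rw [h1]; ring
    have e4 : ⟪P (t • x), P (t • x)⟫ = t * ⟪x, P (t • x)⟫ := by linarith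
    nlinarith
  have h6 : ‖P (t • x) - t • P x‖ ^ 2 = 0 := le_antisymm h5 (sq_nonneg _)
  exact sub_eq_zero.1 (norm_eq_zero.1 (pow_eq_zero_iff (two_ne_zero) |>.1 h6))

theorem norm_sq_eq (x : E) : ‖P x‖ ^ 2 = ⟪P x, x⟫ := by
  have h1 := hP.inner_self x
  rw [← real_inner_self_eq_norm_sq]
  rw [inner_sub_left] at h1
  linarith [real_inner_comm (P x) x]

/-- The convex function `½‖P ·‖²` lies above its linearisations. -/
theorem linearization_le (x y : E) :
    ⟪P x, y - x⟫ ≤ 1 / 2 * ‖P y‖ ^ 2 - 1 / 2 * ‖P x‖ ^ 2 := by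
  have h1 := hP.inner_le y x
  have h3 := hP.norm_sq_eq x
  have h4 : 0 ≤ ‖P x - P y‖ ^ 2 := sq_nonneg _
  rw [norm_sub_sq_real] at h4
  simp only [inner_sub_left, inner_sub_right] at *
  linarith [real_inner_comm (P x) (P y), real_inner_comm (P x) y]

theorem le_linearization (x y : E) :
    1 / 2 * ‖P y‖ ^ 2 - 1 / 2 * ‖P x‖ ^ 2 ≤ ⟪P x, y - x⟫ + ‖y - x‖ ^ 2 := by
  have h1 := hP.linearization_le y x
  have h2 : ⟪P y - P x, y - x⟫ ≤ ‖y - x‖ ^ 2 := by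
    have := real_inner_le_norm (P y - P x) (y - x)
    nlinarith [hP.norm_sub_le y x, norm_nonneg (y - x)]
  have h3 : ⟪P y, x - y⟫ = - ⟪P y, y - x⟫ := by rw [← inner_neg_right, neg_sub]
  rw [inner_sub_left] at h2
  linarith

end IsConeProj

/-- A function that is quadratically close to an affine one has a gradient. -/
theorem hasGradientAt_of_abs_le [CompleteSpace E] {f : E → ℝ} {g x : E} {K : ℝ}
    (h : ∀ y, |f y - f x - ⟪g, y - x⟫| ≤ K * ‖y - x‖ ^ 2) : HasGradientAt f g x := by
  rw [hasGradientAt_iff_isLittleO]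
  refine Asymptotics.IsBigO.trans_isLittleO (g := fun y => ‖y - x‖ ^ 2)
    (Asymptotics.IsBigO.of_bound K (Eventually.of_forall fun y => ?_)) ?_
  · simpa using h y
  · have h0 : Tendsto (fun y => y - x) (𝓝 x) (𝓝 0) := by
      have : Tendsto (fun y => y - x) (𝓝 x) (𝓝 (x - x)) := tendsto_id.sub_const x
      simpa using this
    exact (Asymptotics.isLittleO_norm_pow_id (E' := E) one_lt_two).comp_tendsto h0

theorem IsConeProj.hasGradientAt [CompleteSpace E] {P : E → E} (hP : IsConeProj P) (x : E) :
    HasGradientAt (fun y => 1 / 2 * ‖P y‖ ^ 2) (P x) x :=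
  hasGradientAt_of_abs_le (K := 1) fun y => by
    have := hP.linearization_le x y
    have := hP.le_linearization x y
    rw [abs_le]; constructor <;> nlinarith [sq_nonneg ‖y - x‖]

namespace IsConeProj

variable {P : E → E} (hP : IsConeProj P)
include hP

/-- As `P` is the gradient of `½‖P ·‖²`, its derivative is a Hessian. -/
theorem inner_fderiv_comm [CompleteSpace E] {x : E} (hx : DifferentiableAt ℝ P x) (v w : E) :
    ⟪fderiv ℝ P x v, w⟫ = ⟪v, fderiv ℝ P x w⟫ := by
  have h1 : ∀ y, HasFDerivAt (fun y => 1 / 2 * ‖P y‖ ^ 2)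
      ((InnerProductSpace.toDual ℝ E) (P y)) y := fun y => (hP.hasGradientAt y).hasFDerivAt
  let T : E →L[ℝ] (E →L[ℝ] ℝ) := innerSL ℝ
  have h2 : HasFDerivAt (fun y => T (P y)) (T.comp (fderiv ℝ P x)) x :=
    T.hasFDerivAt.comp x hx.hasFDerivAt
  have h3 := second_derivative_symmetric (f := fun y => 1 / 2 * ‖P y‖ ^ 2)
    (f' := fun y => T (P y)) h1 h2 v w
  change ⟪fderiv ℝ P x v, w⟫ = ⟪fderiv ℝ P x w, v⟫ at h3
  rw [h3, real_inner_comm]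

theorem norm_fderiv_le (x : E) : ‖fderiv ℝ P x‖ ≤ 1 :=
  norm_fderiv_le_of_lipschitz ℝ (C := 1) (LipschitzWith.of_dist_le_mul fun y z => by
    simpa [dist_eq_norm] using hP.norm_sub_le y z)

theorem inner_fderiv_nonneg {x : E} (hx : DifferentiableAt ℝ P x) (v : E) :
    0 ≤ ⟪fderiv ℝ P x v, v⟫ := by
  have h1 : HasDerivAt (fun t : ℝ => P (x + t • v)) (fderiv ℝ P x v) 0 :=
    hx.hasFDerivAt.hasLineDerivAt v
  have h2 := (hasDerivAt_iff_tendsto_slope_zero.1 h1)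
  have h3 : Tendsto (fun t : ℝ => ⟪t⁻¹ • (P (x + (0 + t) • v) - P (x + (0 : ℝ) • v)), v⟫)
      (𝓝[≠] 0) (𝓝 ⟪fderiv ℝ P x v, v⟫) := h2.inner tendsto_const_nhds
  refine ge_of_tendsto h3 ?_
  filter_upwards [self_mem_nhdsWithin] with t ht
  have h4 := hP.norm_sq_le_inner (x + t • v) x
  simp only [add_sub_cancel_left, zero_add, zero_smul, add_zero, inner_smul_left,
    RCLike.conj_to_real] at *
  have h5 : 0 ≤ t * ⟪P (x + t • v) - P x, v⟫ := by
    rw [real_inner_comm]; exact (sq_nonneg _).trans h4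
  have h6 : t⁻¹ * ⟪P (x + t • v) - P x, v⟫ = (t⁻¹) ^ 2 * (t * ⟪P (x + t • v) - P x, v⟫) := by
    field_simp [show t ≠ 0 from ht]
  rw [h6]; positivity

/-- Euler's identity for a positively homogeneous map of degree 1. -/
theorem fderiv_self {x : E} (hx : DifferentiableAt ℝ P x) : fderiv ℝ P x x = P x := by
  have h1 : HasDerivAt (fun t : ℝ => P (x + t • x)) (fderiv ℝ P x x) 0 :=
    hx.hasFDerivAt.hasLineDerivAt x
  have h2 : HasDerivAt (fun t : ℝ => (1 + t) • P x) (P x) 0 := by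
    have := ((hasDerivAt_id (0 : ℝ)).const_add 1).smul_const (P x)
    simpa using this
  have h3 : (fun t : ℝ => P (x + t • x)) =ᶠ[𝓝 0] fun t : ℝ => (1 + t) • P x := by
    filter_upwards [lt_mem_nhds (show (-1 : ℝ) < 0 by norm_num)] with t ht
    rw [← hP.map_smul (by linarith), add_smul, one_smul]
  exact (h1.congr_of_eventuallyEq h3.symm).unique h2

end IsConeProj

/-! ### Passing from derivatives to Clarke's Jacobian. -/

section Clarke

/-- Closedness handles the limits of Jacobians, convexity the hull. -/
theorem clarkeJacobian_subset_of_isClosed {F : E → E} {x : E} {Q : Set (E →L[ℝ] E)}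
    (hQ : Convex ℝ Q) (hc : IsClosed Q) (h : ∀ y, DifferentiableAt ℝ F y → fderiv ℝ F y ∈ Q) :
    clarkeJacobian F x ⊆ Q :=
  convexHull_min (fun _ ⟨u, _, hd, hV⟩ => hc.mem_of_tendsto hV
    (Eventually.of_forall fun k => h (u k) (hd k))) hQ

/-- A quadratic estimate for the Jacobian at points of differentiability passes to Clarke's
generalized Jacobian. -/
theorem clarkeJacobian_quadratic_estimate {F : E → E} (hF : Continuous F) {x : E} {U : Set E}
    (hU : IsOpen U) {C : ℝ} (h : ∀ y ∈ U, DifferentiableAt ℝ F y →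
      ‖F y - F x - fderiv ℝ F y (y - x)‖ ≤ C * ‖y - x‖ ^ 2) {y : E} (hy : y ∈ U)
    {V : E →L[ℝ] E} (hV : V ∈ clarkeJacobian F y) :
    ‖F y - F x - V (y - x)‖ ≤ C * ‖y - x‖ ^ 2 := by
  have hconv : Convex ℝ {V : E →L[ℝ] E | ‖F y - F x - V (y - x)‖ ≤ C * ‖y - x‖ ^ 2} := by
    intro V hV W hW a b ha hb hab
    have : F y - F x - (a • V + b • W) (y - x) =
        a • (F y - F x - V (y - x)) + b • (F y - F x - W (y - x)) := by
      have hb' : b = 1 - a := by linarith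
      subst hb'
      simp only [add_apply, smul_apply]
      module
    rw [Set.mem_ofPred_eq, this]
    refine (norm_add_le _ _).trans ?_
    rw [norm_smul, norm_smul, Real.norm_of_nonneg ha, Real.norm_of_nonneg hb]
    have e1 := mul_le_mul_of_nonneg_left (Set.mem_ofPred_eq ▸ hV) ha
    have e2 := mul_le_mul_of_nonneg_left (Set.mem_ofPred_eq ▸ hW) hb
    have : C * ‖y - x‖ ^ 2 = a * (C * ‖y - x‖ ^ 2) + b * (C * ‖y - x‖ ^ 2) := by
      rw [← add_mul, hab, one_mul]
    linarith
  refine convexHull_min ?_ hconv hV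
  rintro V ⟨u, hu, hd, hV⟩
  have h1 : Tendsto (fun k => ‖F (u k) - F x - fderiv ℝ F (u k) (u k - x)‖) atTop
      (𝓝 ‖F y - F x - V (y - x)‖) :=
    ((((hF.tendsto y).comp hu).sub_const _).sub ((isBoundedBilinearMap_apply.continuous.tendsto
      (V, y - x)).comp (hV.prodMk_nhds (hu.sub_const x)))).norm
  have h2 : Tendsto (fun k => C * ‖u k - x‖ ^ 2) atTop (𝓝 (C * ‖y - x‖ ^ 2)) :=
    (((hu.sub_const x).norm).pow 2).const_mul C
  refine le_of_tendsto_of_tendsto h1 h2 ?_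
  -- Openness of `U` puts the approximating points of differentiability in `U`; the base point `x`
  -- stays fixed.
  filter_upwards [hu.eventually (hU.mem_nhds hy)] with k hk
  exact h _ hk (hd k)

variable {P : E → E} (hP : IsConeProj P) {x : E} {V : E →L[ℝ] E} (hV : V ∈ clarkeJacobian P x)
include hP hV

theorem IsConeProj.clarke_inner_comm [CompleteSpace E] (v w : E) : ⟪V v, w⟫ = ⟪v, V w⟫ := by
  refine clarkeJacobian_subset_of_isClosed (Q := {V | ⟪V v, w⟫ = ⟪v, V w⟫}) ?_ ?_
    (fun y hy => hP.inner_fderiv_comm hy v w) hV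
  · intro V hV W hW a b _ _ _
    simp only [Set.mem_ofPred_eq, add_apply, smul_apply,
      inner_add_left, inner_add_right, inner_smul_left, inner_smul_right] at *
    rw [hV, hW]; simp
  · exact isClosed_eq (by fun_prop) (by fun_prop)

theorem IsConeProj.clarke_inner_nonneg (v : E) : 0 ≤ ⟪V v, v⟫ := by
  refine clarkeJacobian_subset_of_isClosed (Q := {V | 0 ≤ ⟪V v, v⟫}) ?_ ?_
    (fun y hy => hP.inner_fderiv_nonneg hy v) hV
  · intro V hV W hW a b ha hb _
    simp only [Set.mem_ofPred_eq, add_apply, smul_apply,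
      inner_add_left, inner_smul_left, RCLike.conj_to_real] at *
    positivity
  · exact isClosed_le (by fun_prop) (by fun_prop)

theorem IsConeProj.clarke_norm_le : ‖V‖ ≤ 1 := by
  have := clarkeJacobian_subset_of_isClosed (Q := Metric.closedBall 0 1) (F := P) (x := x)
    (convex_closedBall _ _) Metric.isClosed_closedBall
    (fun y _ => by simpa using hP.norm_fderiv_le y) hV
  simpa using this

end Clarke

end ConeProj

/-! ### Conjugate gradients and the Galerkin condition. -/

section ConjugateGradient

variable {E : Type*} [NormedAddCommGroup E] [InnerProductSpace ℝ E] {A : E →L[ℝ] E} {b : E}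

theorem cgState_p_eq_zero {k : ℕ} (h : (cgState A b k).r = 0) : (cgState A b k).p = 0 := by
  cases k with
  | zero => exact h
  | succ k =>
    simp only [cgState] at h ⊢
    rw [h]; simp

theorem cgState_r_eq (k : ℕ) : (cgState A b k).r = b - A (cgState A b k).x := by
  induction k with
  | zero => simp [cgState]
  | succ k ih =>
    simp only [cgState, map_add, map_smul]
    rw [ih]; abel

/-- Orthogonality relations between the residuals and the directions of the conjugate gradient
method. -/
theorem cgState_orthogonality (hA : ∀ v w, ⟪A v, w⟫ = ⟪v, A w⟫)
    (hpos : ∀ v, ‖v‖ ^ 2 ≤ ⟪A v, v⟫) (k : ℕ) :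
    ⟪(cgState A b k).p, (cgState A b k).r⟫ = ‖(cgState A b k).r‖ ^ 2 ∧
    (∀ j < k, ⟪(cgState A b k).r, (cgState A b j).p⟫ = 0) ∧
    (∀ j < k, ⟪(cgState A b k).p, A (cgState A b j).p⟫ = 0) := by
  induction k using Nat.strong_induction_on with
  | _ k ih =>
  cases k with
  | zero => simp [cgState]
  | succ k =>
  obtain ⟨hpr, hrp, hpp⟩ := ih k (Nat.lt_succ_self k)
  -- After termination all quotients have numerator 0, so residual and direction remain 0 and every
  -- relation is trivial.
  by_cases hr0 : (cgState A b k).r = 0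
  · have h1 : (cgState A b (k + 1)).r = 0 := by simp [cgState, hr0]
    have h2 := cgState_p_eq_zero h1
    simp [h1, h2]
  have hden : ∀ j ≤ k, (cgState A b j).r ≠ 0 →
      0 < ⟪(cgState A b j).p, A (cgState A b j).p⟫ := by
    intro j hj hr
    have hp : (cgState A b j).p ≠ 0 := by
      intro h0
      have := (ih j (by omega)).1
      rw [h0, inner_zero_left] at this
      exact hr (norm_eq_zero.1 (pow_eq_zero_iff two_ne_zero |>.1 this.symm))
    have h1 := hpos (cgState A b j).p
    rw [hA] at h1
    exact lt_of_lt_of_le (by positivity) h1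
  set a : ℕ → ℝ := fun j => ⟪(cgState A b j).r, (cgState A b j).r⟫ /
    ⟪(cgState A b j).p, A (cgState A b j).p⟫ with ha
  have hr' : ∀ j, (cgState A b (j + 1)).r = (cgState A b j).r - a j • A (cgState A b j).p :=
    fun j => rfl
  set β : ℕ → ℝ := fun j => ⟪(cgState A b (j + 1)).r, (cgState A b (j + 1)).r⟫ /
    ⟪(cgState A b j).r, (cgState A b j).r⟫ with hβ
  have hp' : ∀ j, (cgState A b (j + 1)).p = (cgState A b (j + 1)).r + β j • (cgState A b j).p :=
    fun j => rfl
  have hrr : ⟪(cgState A b k).r, (cgState A b k).r⟫ ≠ 0 := by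
    rwa [Ne, inner_self_eq_zero]
  have hdk := hden k le_rfl hr0
  have h1 : ∀ j < k + 1, ⟪(cgState A b (k + 1)).r, (cgState A b j).p⟫ = 0 := by
    intro j hj
    rw [hr', inner_sub_left, inner_smul_left, RCLike.conj_to_real, hA]
    rcases Nat.lt_succ_iff_lt_or_eq.1 hj with hj | rfl
    · rw [hrp j hj, hpp j hj]; simp
    · rw [real_inner_comm, hpr, ← real_inner_self_eq_norm_sq, ha]
      field_simp
      simp
  have h2 : ∀ j < k + 1, ⟪(cgState A b (k + 1)).r, (cgState A b j).r⟫ = 0 := by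
    intro j hj
    cases j with
    | zero => exact h1 0 hj
    | succ j =>
      have e : (cgState A b (j + 1)).r = (cgState A b (j + 1)).p - β j • (cgState A b j).p := by
        rw [hp']; abel
      rw [e, inner_sub_right, inner_smul_right, h1 _ hj, h1 j (by omega)]; simp
  refine ⟨?_, h1, ?_⟩
  · rw [hp', inner_add_left, inner_smul_left, real_inner_self_eq_norm_sq, real_inner_comm,
      h1 k (Nat.lt_succ_self k)]
    simp
  · intro j hj
    -- `a j • A p_j` is the difference of consecutive residuals, which are mutually orthogonal; only
    -- `j = k` leaves a term, and `β` is chosen to cancel it.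
    have h3 : a j * ⟪(cgState A b (k + 1)).r, A (cgState A b j).p⟫ =
        - ⟪(cgState A b (k + 1)).r, (cgState A b (j + 1)).r⟫ := by
      rw [hr' j, inner_sub_right, h2 j hj, inner_smul_right]; ring
    rcases Nat.lt_succ_iff_lt_or_eq.1 hj with hj' | rfl
    · by_cases hrj : (cgState A b j).r = 0
      · rw [cgState_p_eq_zero hrj]; simp
      have haj : a j ≠ 0 :=
        div_ne_zero (by rwa [Ne, inner_self_eq_zero]) (hden j hj'.le hrj).ne'
      rw [h2 (j + 1) (by omega), neg_zero] at h3
      rw [hp', inner_add_left, inner_smul_left, hpp j hj', (mul_eq_zero.1 h3).resolve_left haj]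
      simp
    · have haj : a j ≠ 0 := div_ne_zero hrr hdk.ne'
      have h4 : ⟪(cgState A b (j + 1)).r, A (cgState A b j).p⟫ =
          - ⟪(cgState A b (j + 1)).r, (cgState A b (j + 1)).r⟫ / a j := by
        rw [eq_div_iff haj, mul_comm, h3]
      rw [hp', inner_add_left, inner_smul_left, h4, RCLike.conj_to_real]
      simp only [hβ, ha]
      field_simp
      ring

/-- The `k`-th iterate is a combination of the first `k` directions. -/
theorem inner_cgState_x_eq_zero {v : E} {k : ℕ} (h : ∀ j < k, ⟪v, (cgState A b j).p⟫ = 0) :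
    ⟪v, (cgState A b k).x⟫ = 0 := by
  induction k with
  | zero => simp [cgState]
  | succ k ih =>
    simp only [cgState, inner_add_right, inner_smul_right]
    rw [ih fun j hj => h j (by omega), h k (Nat.lt_succ_self k)]; simp

/-- The iterates of the conjugate gradient method satisfy the Galerkin condition. -/
theorem IsCGOutput.inner_eq (hA : ∀ v w, ⟪A v, w⟫ = ⟪v, A w⟫)
    (hpos : ∀ v, ‖v‖ ^ 2 ≤ ⟪A v, v⟫) {tol : ℝ} {d : E} (h : IsCGOutput A b tol d) :
    ⟪b, d⟫ = ⟪A d, d⟫ := by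
  obtain ⟨k, -, rfl⟩ := h
  have := inner_cgState_x_eq_zero (cgState_orthogonality (b := b) hA hpos k).2.1
  rw [cgState_r_eq, inner_sub_left] at this
  linarith

theorem IsCGOutput.norm_le {tol : ℝ} {d : E} (h : IsCGOutput A b tol d) :
    ‖A d - b‖ ≤ tol := by
  obtain ⟨k, hk, rfl⟩ := h
  exact hk.1

end ConjugateGradient

/-! ### Abstract damped inexact Newton method. -/

section InexactNewton

variable {E : Type*} [NormedAddCommGroup E] [InnerProductSpace ℝ E]

/-- A damped inexact Newton step from `x` to `x'` for minimizing `f`, with gradient `g` and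
generalized Hessians `H`. The direction satisfies the Galerkin condition, and the step size is
found by backtracking. -/
def IsInexactNewtonStep (f : E → ℝ) (g : E → E) (H : E → Set (E →L[ℝ] E)) (μ η τ δ : ℝ)
    (x x' : E) : Prop :=
  ∃ A ∈ H x, ∃ d : E, ⟪-g x, d⟫ = ⟪A d, d⟫ ∧ ‖A d + g x‖ ≤ min η (‖g x‖ ^ (1 + τ)) ∧
    ∃ m : ℕ, IsLeast {m : ℕ | f (x + δ ^ m • d) ≤ f x + μ * δ ^ m * ⟪g x, d⟫} m ∧
      x' = x + δ ^ m • d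

/-- Makes the stopping tolerance a fixed fraction of the gradient norm. The two bounds are compared
at the threshold `s = √η`. -/
theorem min_rpow_le_mul {η τ s : ℝ} (hη : η ∈ Set.Ioo (0 : ℝ) 1) (hτ : τ ∈ Set.Ioc (0 : ℝ) 1)
    (hs : 0 ≤ s) : min η (s ^ (1 + τ)) ≤ η ^ (τ / 2) * s := by
  obtain ⟨hη0, hη1⟩ := hη
  obtain ⟨hτ0, hτ1⟩ := hτ
  rcases le_or_gt (η ^ (1 / 2 : ℝ)) s with h | h
  · refine (min_le_left _ _).trans ?_
    calc η = η ^ (1 / 2 : ℝ) * η ^ (1 / 2 : ℝ) := by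
          rw [← Real.rpow_add hη0]; norm_num
      _ ≤ η ^ (τ / 2) * s := mul_le_mul
          (Real.rpow_le_rpow_of_exponent_ge hη0 hη1.le (by linarith)) h (by positivity)
          (by positivity)
  · refine (min_le_right _ _).trans ?_
    rw [add_comm, Real.rpow_add_one' hs (by linarith)]
    refine mul_le_mul_of_nonneg_right ?_ hs
    calc s ^ τ ≤ (η ^ (1 / 2 : ℝ)) ^ τ := Real.rpow_le_rpow hs h.le hτ0.le
      _ = η ^ (τ / 2) := by rw [← Real.rpow_mul hη0.le]; congr 1; ring

variable {f : E → ℝ} {g : E → E} {H : E → Set (E →L[ℝ] E)} {μ η τ δ K L : ℝ}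

theorem IsInexactNewtonStep.exists_sufficient_decrease
    (hμ : μ ∈ Set.Ioo (0 : ℝ) (1 / 2)) (hη : η ∈ Set.Ioo (0 : ℝ) 1)
    (hτ : τ ∈ Set.Ioc (0 : ℝ) 1) (hδ : δ ∈ Set.Ioo (0 : ℝ) 1) (hK : 0 < K) (hL : 0 < L)
    (hup : ∀ x y, f y - f x ≤ ⟪g x, y - x⟫ + K * ‖y - x‖ ^ 2)
    (hcoer : ∀ x, ∀ A ∈ H x, ∀ v, ‖v‖ ^ 2 ≤ ⟪A v, v⟫)
    (hbdd : ∀ x, ∀ A ∈ H x, ∀ v, ‖A v‖ ≤ L * ‖v‖) :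
    ∃ c > 0, ∀ x x', IsInexactNewtonStep f g H μ η τ δ x x' → f x' ≤ f x - c * ‖g x‖ ^ 2 := by
  have hμ0 := hμ.1
  have hμ1 : 0 < 1 - μ := by linarith [hμ.2]
  have hδ0 := hδ.1
  set θ := η ^ (τ / 2) with hθ
  have hθ1 : 0 < 1 - θ := by
    have := Real.rpow_lt_one hη.1.le hη.2 (show 0 < τ / 2 by linarith [hτ.1])
    linarith
  set a := min 1 (δ * ((1 - μ) / K)) with ha
  have ha0 : 0 < a := lt_min one_pos (by positivity)
  refine ⟨μ * a * ((1 - θ) / L) ^ 2, by positivity, ?_⟩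
  rintro x x' ⟨A, hA, d, hd, htol, m, hm, rfl⟩
  have hq : ‖d‖ ^ 2 ≤ ⟪-g x, d⟫ := hd ▸ hcoer x A hA d
  rw [inner_neg_left] at hq
  have hdg : (1 - θ) / L * ‖g x‖ ≤ ‖d‖ := by
    have h1 := hbdd x A hA d
    have h2 := htol.trans (min_rpow_le_mul hη hτ (norm_nonneg (g x)))
    have h3 : ‖g x‖ ≤ ‖A d + g x‖ + ‖A d‖ := by
      have := norm_sub_le (A d + g x) (A d)
      rwa [add_sub_cancel_left] at this
    rw [div_mul_eq_mul_div, div_le_iff₀ hL]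
    linarith
  have ht : a ≤ δ ^ m := by
    cases m with
    | zero => simp [ha]
    | succ k =>
      -- The exponent just before the accepted one was rejected.
      have hk : k ∉ {m : ℕ | f (x + δ ^ m • d) ≤ f x + μ * δ ^ m * ⟪g x, d⟫} := fun h =>
        absurd (hm.2 h) (by omega)
      rw [Set.mem_ofPred_eq, not_le] at hk
      have h1 := hup x (x + δ ^ k • d)
      have hs : 0 < δ ^ k := pow_pos hδ0 k
      rw [add_sub_cancel_left, inner_smul_right, norm_smul, Real.norm_of_nonneg hs.le] at h1
      set s := δ ^ k
      set q := -⟪g x, d⟫ with hqdef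
      have hgq : ⟪g x, d⟫ = -q := by rw [hqdef]; ring
      rw [hgq] at h1 hk
      have h2 : s * ((1 - μ) * q) < s * (K * s * ‖d‖ ^ 2) := by nlinarith
      have h3 : (1 - μ) * q < K * s * ‖d‖ ^ 2 := lt_of_mul_lt_mul_left h2 hs.le
      have h4 : (1 - μ) * q < K * s * q :=
        h3.trans_le (mul_le_mul_of_nonneg_left hq (by positivity))
      have h5 : 0 ≤ q := (sq_nonneg _).trans hq
      have h6 : 1 - μ < K * s := lt_of_mul_lt_mul_right h4 h5
      refine (min_le_right _ _).trans ?_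
      rw [pow_succ, mul_comm]
      refine mul_le_mul_of_nonneg_right ?_ hδ0.le
      rw [div_le_iff₀ hK]; linarith
  have hm1 : f (x + δ ^ m • d) ≤ f x + μ * δ ^ m * ⟪g x, d⟫ := hm.1
  have h1 : ((1 - θ) / L) ^ 2 * ‖g x‖ ^ 2 ≤ -⟪g x, d⟫ := by
    rw [← mul_pow]
    exact (pow_le_pow_left₀ (by positivity) hdg 2).trans hq
  have h2 : μ * a * (((1 - θ) / L) ^ 2 * ‖g x‖ ^ 2) ≤ μ * δ ^ m * (-⟪g x, d⟫) :=
    mul_le_mul (mul_le_mul_of_nonneg_left ht hμ0.le) h1 (by positivity) (by positivity)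
  linarith

/-- The antitone sequence `u` is bounded below, hence converges, so its consecutive differences,
which dominate `c * v j ^ 2`, tend to 0. -/
theorem tendsto_zero_of_sufficient_decrease {u v : ℕ → ℝ} {c : ℝ} (hc : 0 < c)
    (hu : ∀ j, 0 ≤ u j) (h : ∀ j, u (j + 1) ≤ u j - c * v j ^ 2) :
    Tendsto v atTop (𝓝 0) := by
  have hanti : Antitone u := antitone_nat_of_succ_le fun j =>
    (h j).trans (by nlinarith [mul_nonneg hc.le (sq_nonneg (v j))])
  have hlim := tendsto_atTop_ciInf hanti ⟨0, by rintro _ ⟨j, rfl⟩; exact hu j⟩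
  have hdiff := (hlim.sub (hlim.comp (tendsto_add_atTop_nat 1))).div_const c
  rw [sub_self, zero_div] at hdiff
  have hsq : Tendsto (fun j => v j ^ 2) atTop (𝓝 0) :=
    squeeze_zero (fun j => sq_nonneg _) (fun j => by
      simp only [Function.comp_apply]
      rw [le_div_iff₀ hc]; linarith [h j]) hdiff
  have habs : Tendsto (fun j => √(v j ^ 2)) atTop (𝓝 0) := by
    simpa using hsq.sqrt
  simp only [Real.sqrt_sq_eq_abs] at habs
  exact (tendsto_zero_iff_abs_tendsto_zero v).2 habs

/-- Near a stationary point the unit step is accepted and the error contracts with order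
`1 + τ`. -/
theorem IsInexactNewtonStep.exists_local_rate
    (hμ : μ ∈ Set.Ioo (0 : ℝ) (1 / 2)) (hτ : τ ∈ Set.Ioc (0 : ℝ) 1)
    (hK : 0 < K) (hL : 0 < L)
    (hup : ∀ x y, f y - f x ≤ ⟪g x, y - x⟫ + K * ‖y - x‖ ^ 2)
    (hlip : ∀ x y, ‖g x - g y‖ ≤ L * ‖x - y‖)
    (hcoer : ∀ x, ∀ A ∈ H x, ∀ v, ‖v‖ ^ 2 ≤ ⟪A v, v⟫)
    {z : E} (hz : g z = 0)
    (hss : ∃ C, ∀ᶠ x in 𝓝 z, ∀ A ∈ H x, ‖g x - g z - A (x - z)‖ ≤ C * ‖x - z‖ ^ 2)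
    (htrap : ∃ C, ∀ᶠ x in 𝓝 z,
      |f x - f z - 1 / 2 * ⟪g x + g z, x - z⟫| ≤ C * ‖x - z‖ ^ 3) :
    ∃ M, ∀ᶠ x in 𝓝 z, ∀ x', IsInexactNewtonStep f g H μ η τ δ x x' →
      ‖x' - z‖ ≤ M * ‖x - z‖ ^ (1 + τ) := by
  obtain ⟨C₁, hC₁⟩ := hss
  obtain ⟨C₂, hC₂⟩ := htrap
  have hτ0 := hτ.1
  set M := |C₁| + L ^ (1 + τ) with hM
  have hM0 : 0 ≤ M := by positivity
  refine ⟨M, ?_⟩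
  have hnorm : Tendsto (fun x => ‖x - z‖) (𝓝 z) (𝓝 0) := by
    have : Tendsto (fun x => ‖x - z‖) (𝓝 z) (𝓝 ‖z - z‖) :=
      (tendsto_id.sub_const z).norm
    simpa using this
  have hq0 : Tendsto (fun x => ‖x - z‖ ^ τ) (𝓝 z) (𝓝 0) := by
    have := hnorm.rpow_const (p := τ) (Or.inr hτ0.le)
    rwa [Real.zero_rpow hτ0.ne'] at this
  have hq1 : Tendsto (fun x => M * ‖x - z‖ ^ τ) (𝓝 z) (𝓝 0) := by
    simpa using hq0.const_mul M
  -- The three error terms of the unit-step test divided by `h²`: from `K‖e‖²`, from `½⟪g x, e⟫` and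
  -- from the trapezoidal remainder. They must stay below `(1/2 - μ)/4`, as `-⟪g x, d⟫ ≥ h²/4`.
  have hq2 : Tendsto (fun x => K * M ^ 2 * (‖x - z‖ ^ τ) ^ 2 + 1 / 2 * L * M * ‖x - z‖ ^ τ +
      |C₂| * ‖x - z‖ ^ τ) (𝓝 z) (𝓝 0) := by
    simpa using (((hq0.pow 2).const_mul (K * M ^ 2)).add (hq0.const_mul (1 / 2 * L * M))).add
      (hq0.const_mul |C₂|)
  have hμ' : 0 < (1 / 2 - μ) / 4 := by linarith [hμ.2]
  filter_upwards [hC₁, hC₂, hnorm.eventually (gt_mem_nhds one_pos),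
    hq1.eventually (gt_mem_nhds (show (0 : ℝ) < 1 / 2 by norm_num)),
    hq2.eventually (gt_mem_nhds hμ')] with x h1 h2 hx1 hqM hqs
  rintro x' ⟨A, hA, d, hd, htol, m, hm, rfl⟩
  set h := ‖x - z‖ with hh
  set q := h ^ τ with hq
  have hh0 : 0 ≤ h := norm_nonneg _
  have hqn : 0 ≤ q := by positivity
  have hp : h ^ (1 + τ) = h * q := by
    rw [add_comm, Real.rpow_add_one' hh0 (by linarith), mul_comm]
  have hhq : h ≤ q := by
    have := Real.rpow_le_rpow_of_exponent_ge' hh0 hx1.le hτ0.le hτ.2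
    rwa [Real.rpow_one] at this
  have hgx : ‖g x‖ ≤ L * h := by simpa [hz] using hlip x z
  have hgd : ‖d‖ ^ 2 ≤ -⟪g x, d⟫ := by
    rw [← inner_neg_left, hd]; exact hcoer x A hA d
  have hh2 : h ^ 2 ≤ h * q := by rw [sq]; exact mul_le_mul_of_nonneg_left hhq hh0
  have he : ‖x + d - z‖ ≤ M * h ^ (1 + τ) := by
    have e1 := h1 A hA
    have e2 : ‖g x‖ ^ (1 + τ) ≤ L ^ (1 + τ) * h ^ (1 + τ) := by
      rw [← Real.mul_rpow hL.le hh0]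
      exact Real.rpow_le_rpow (norm_nonneg _) hgx (by linarith)
    have e3 : ‖x + d - z‖ ≤ ‖A (x + d - z)‖ := by
      have e := (hcoer x A hA (x + d - z)).trans (real_inner_le_norm _ _)
      by_contra! hc
      nlinarith [norm_nonneg (A (x + d - z))]
    -- Linear-solver residual minus semismoothness error; coercivity of `A` turns this into a bound
    -- on the new error.
    have e4 : A (x + d - z) = (A d + g x) - (g x - g z - A (x - z)) := by
      rw [hz]; simp only [map_add, map_sub]; abel
    have e5 : C₁ * h ^ 2 ≤ |C₁| * h ^ (1 + τ) := by
      rw [hp]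
      exact mul_le_mul (le_abs_self _) hh2 (by positivity) (abs_nonneg _)
    calc ‖x + d - z‖ ≤ ‖A (x + d - z)‖ := e3
      _ ≤ ‖A d + g x‖ + ‖g x - g z - A (x - z)‖ := by rw [e4]; exact norm_sub_le _ _
      _ ≤ ‖g x‖ ^ (1 + τ) + C₁ * h ^ 2 := add_le_add (htol.trans (min_le_right _ _)) e1
      _ ≤ M * h ^ (1 + τ) := by rw [hM, add_mul]; linarith
  suffices hm0 : m = 0 by
    subst hm0; simpa using he
  -- By minimality of `m`, it suffices that the unit step passes the Armijo test.
  refine Nat.le_zero.1 (hm.2 ?_)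
  rw [Set.mem_ofPred_eq, pow_zero, one_smul, mul_one]
  set e := x + d - z with hedef
  rw [hp] at he
  have heh : ‖e‖ ≤ h / 2 := by
    have := mul_le_mul_of_nonneg_left hqM.le hh0
    linarith
  have hdh : h / 2 ≤ ‖d‖ := by
    have e1 : x - z = e - d := by rw [hedef]; abel
    have e2 := norm_sub_le e d
    rw [← e1] at e2
    linarith
  have hgd' : h ^ 2 / 4 ≤ -⟪g x, d⟫ := by
    have := pow_le_pow_left₀ (by positivity) hdh 2
    linarith
  have hfe : f (x + d) - f z ≤ K * ‖e‖ ^ 2 := by simpa [hz] using hup z (x + d)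
  have hfx := (abs_le.1 h2).1
  have hxz : x - z = e - d := by rw [hedef]; abel
  rw [hz, add_zero, hxz, inner_sub_right] at hfx
  have hge : -⟪g x, e⟫ ≤ L * h * (M * (h * q)) :=
    (neg_le_abs _).trans <| (abs_real_inner_le_norm _ _).trans (mul_le_mul hgx he (norm_nonneg _) (by positivity))
  have he2 : K * ‖e‖ ^ 2 ≤ K * (M * (h * q)) ^ 2 :=
    mul_le_mul_of_nonneg_left (pow_le_pow_left₀ (norm_nonneg _) he 2) hK.le
  have hc2 : C₂ * h ^ 3 ≤ |C₂| * (h ^ 2 * q) := by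
    refine mul_le_mul (le_abs_self _) ?_ (by positivity) (abs_nonneg _)
    rw [pow_succ]; exact mul_le_mul_of_nonneg_left hhq (by positivity)
  have hfin := mul_le_mul_of_nonneg_left hqs.le (sq_nonneg h)
  have hfin2 := mul_le_mul_of_nonneg_left hgd' (show 0 ≤ 1 / 2 - μ by linarith [hμ.2])
  linarith

/-- Global convergence, with local order `1 + τ`, of the inexact Newton method for strongly convex
functions. -/
theorem inexactNewton_converges [CompleteSpace E]
    (hμ : μ ∈ Set.Ioo (0 : ℝ) (1 / 2)) (hη : η ∈ Set.Ioo (0 : ℝ) 1)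
    (hτ : τ ∈ Set.Ioc (0 : ℝ) 1) (hδ : δ ∈ Set.Ioo (0 : ℝ) 1) (hK : 0 < K) (hL : 0 < L)
    (hf : ∀ x, 0 ≤ f x)
    (hlow : ∀ x y, ⟪g x, y - x⟫ + 1 / 2 * ‖y - x‖ ^ 2 ≤ f y - f x)
    (hup : ∀ x y, f y - f x ≤ ⟪g x, y - x⟫ + K * ‖y - x‖ ^ 2)
    (hlip : ∀ x y, ‖g x - g y‖ ≤ L * ‖x - y‖)
    (hcoer : ∀ x, ∀ A ∈ H x, ∀ v, ‖v‖ ^ 2 ≤ ⟪A v, v⟫)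
    (hbdd : ∀ x, ∀ A ∈ H x, ∀ v, ‖A v‖ ≤ L * ‖v‖)
    (hss : ∀ z, ∃ C, ∀ᶠ x in 𝓝 z, ∀ A ∈ H x, ‖g x - g z - A (x - z)‖ ≤ C * ‖x - z‖ ^ 2)
    (htrap : ∀ z, ∃ C, ∀ᶠ x in 𝓝 z,
      |f x - f z - 1 / 2 * ⟪g x + g z, x - z⟫| ≤ C * ‖x - z‖ ^ 3)
    {X : ℕ → E} (hX : ∀ j, IsInexactNewtonStep f g H μ η τ δ (X j) (X (j + 1))) :
    ∃ z, (∀ y, f z ≤ f y) ∧ (∀ y, (∀ w, f y ≤ f w) → y = z) ∧ Tendsto X atTop (𝓝 z) ∧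
      (fun j => ‖X (j + 1) - z‖) =O[atTop] (fun j => ‖X j - z‖ ^ (1 + τ)) := by
  obtain ⟨c, hc, hdec⟩ := IsInexactNewtonStep.exists_sufficient_decrease hμ hη hτ hδ hK hL hup
    hcoer hbdd
  have hg0 : Tendsto (fun j => g (X j)) atTop (𝓝 0) := tendsto_zero_iff_norm_tendsto_zero.2
    (tendsto_zero_of_sufficient_decrease hc (fun j => hf (X j)) fun j => hdec _ _ (hX j))
  -- Adding the two strong convexity inequalities gives strong monotonicity of `g`; Cauchy gradients
  -- then force Cauchy iterates.
  have hmono : ∀ x y, ‖x - y‖ ≤ ‖g x - g y‖ := by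
    intro x y
    have h1 := hlow x y
    have h2 := hlow y x
    have h3 : ⟪g x, y - x⟫ = -⟪g x, x - y⟫ := by rw [← inner_neg_right, neg_sub]
    have h4 := real_inner_le_norm (g x - g y) (x - y)
    rw [inner_sub_left] at h4
    rw [norm_sub_rev y x] at h1
    by_contra! hlt
    nlinarith [norm_nonneg (g x - g y)]
  have hcauchy : CauchySeq X := by
    rw [Metric.cauchySeq_iff]
    intro ε hε
    obtain ⟨N, hN⟩ := Metric.cauchySeq_iff.1 hg0.cauchySeq ε hε
    refine ⟨N, fun m hm k hk => ?_⟩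
    have := hN m hm k hk
    rw [dist_eq_norm] at this ⊢
    exact (hmono _ _).trans_lt this
  obtain ⟨z, hz⟩ := cauchySeq_tendsto_of_complete hcauchy
  have hgcont : Continuous g := (LipschitzWith.of_dist_le_mul (K := ⟨L, hL.le⟩) fun x y => by
    rw [dist_eq_norm, dist_eq_norm]; exact hlip x y).continuous
  have hgz : g z = 0 := tendsto_nhds_unique ((hgcont.tendsto z).comp hz) hg0
  have hmin : ∀ y, f z + 1 / 2 * ‖y - z‖ ^ 2 ≤ f y := by
    intro y
    have := hlow z y
    rw [hgz, inner_zero_left] at this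
    linarith
  refine ⟨z, fun y => ?_, fun y hy => ?_, hz, ?_⟩
  · nlinarith [hmin y, sq_nonneg ‖y - z‖]
  · have h1 := hmin y
    have h2 := hy z
    have h3 : ‖y - z‖ ^ 2 = 0 := le_antisymm (by linarith) (sq_nonneg _)
    exact sub_eq_zero.1 (norm_eq_zero.1 (pow_eq_zero_iff two_ne_zero |>.1 h3))
  · obtain ⟨M, hM⟩ := IsInexactNewtonStep.exists_local_rate (η := η) (δ := δ) hμ hτ hK hL hup hlip
      hcoer hgz (hss z) (htrap z)
    refine Asymptotics.IsBigO.of_bound M ?_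
    filter_upwards [hz.eventually hM] with j hj
    rw [Real.norm_of_nonneg (norm_nonneg _), Real.norm_of_nonneg (by positivity)]
    exact hj _ (hX j)

end InexactNewton

variable {n : ℕ}

/-! ### Matrix entries in orthonormal bases. -/

section Coordinates

/-- The entry of `Uᵀ M V` at `(i, j)`, as a function of the symmetric matrix `M`. -/
noncomputable def entryCLM (U V : Matrix (Fin n) (Fin n) ℝ) (i j : Fin n) : SymMat n →L[ℝ] ℝ :=
  LinearMap.toContinuousLinearMap
    { toFun := fun M => (U.transpose * M.toMatrix * V) i j
      map_add' := fun A B => by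
        have : (A + B).toMatrix = A.toMatrix + B.toMatrix := rfl
        simp [this, mul_add, add_mul]
      map_smul' := fun c A => by
        have : (c • A).toMatrix = c • A.toMatrix := rfl
        simp [this] }

theorem entryCLM_apply (U V : Matrix (Fin n) (Fin n) ℝ) (i j : Fin n) (M : SymMat n) :
    entryCLM U V i j M = (U.transpose * M.toMatrix * V) i j := rfl

/-- The element of `𝕊ⁿ` given by a symmetric matrix. -/
def SymMat.ofMatrix (M : Matrix (Fin n) (Fin n) ℝ) (h : M.IsSymm) : SymMat n :=
  ⟨WithLp.toLp 2 fun p => M p.1 p.2, fun i j => by simpa using h.apply j i⟩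

theorem SymMat.toMatrix_sub (A B : SymMat n) :
    (A - B).toMatrix = A.toMatrix - B.toMatrix := rfl

theorem SymMat.toMatrix_add (A B : SymMat n) :
    (A + B).toMatrix = A.toMatrix + B.toMatrix := rfl

theorem SymMat.toMatrix_smul (c : ℝ) (A : SymMat n) :
    (c • A).toMatrix = c • A.toMatrix := rfl

variable {U V : Matrix (Fin n) (Fin n) ℝ}

theorem entryCLM_comm (M : SymMat n) (i j : Fin n) :
    entryCLM U U i j M = entryCLM U U j i M := by
  have h : (U.transpose * M.toMatrix * U).IsSymm := by
    rw [Matrix.IsSymm, Matrix.transpose_mul, Matrix.transpose_mul, Matrix.transpose_transpose,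
      M.toMatrix_isSymm, mul_assoc]
  exact h.apply j i

/-- Orthogonal invariance of the Frobenius product. Two different bases are allowed because the
overlap estimate mixes eigenvectors of two matrices. -/
theorem inner_eq_sum_entryCLM (hU : U * U.transpose = 1) (hV : V * V.transpose = 1)
    (A B : SymMat n) : ⟪A, B⟫ = ∑ i, ∑ j, entryCLM U V i j A * entryCLM U V i j B := by
  have h : ⟪A, B⟫ = ((U.transpose * A.toMatrix * V).transpose *
      (U.transpose * B.toMatrix * V)).trace := by
    rw [SymMat.inner_eq_trace]
    simp only [Matrix.transpose_mul, Matrix.transpose_transpose]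
    rw [Matrix.mul_assoc V.transpose, Matrix.trace_mul_comm V.transpose]
    congr 1
    calc A.toMatrix.transpose * B.toMatrix
        = A.toMatrix.transpose * (U * U.transpose) * B.toMatrix * (V * V.transpose) := by
          rw [hU, hV, mul_one, mul_one]
      _ = _ := by simp only [Matrix.mul_assoc]
  rw [h, Finset.sum_comm]
  simp only [Matrix.trace, Matrix.diag, Matrix.mul_apply (M := Matrix.transpose _),
    Matrix.transpose_apply (M := _ * V), entryCLM_apply]

theorem norm_sq_eq_sum_entryCLM (hU : U * U.transpose = 1) (hV : V * V.transpose = 1)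
    (A : SymMat n) : ‖A‖ ^ 2 = ∑ i, ∑ j, entryCLM U V i j A ^ 2 := by
  rw [← real_inner_self_eq_norm_sq, inner_eq_sum_entryCLM hU hV]
  simp only [sq]

theorem abs_entryCLM_le (hU : U * U.transpose = 1) (hV : V * V.transpose = 1)
    (A : SymMat n) (i j : Fin n) : |entryCLM U V i j A| ≤ ‖A‖ := by
  refine abs_le_of_sq_le_sq ?_ (norm_nonneg _)
  rw [norm_sq_eq_sum_entryCLM hU hV]
  exact (Finset.single_le_sum (f := fun j => entryCLM U V i j A ^ 2)
    (fun _ _ => sq_nonneg _) (Finset.mem_univ j)).trans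
    (Finset.single_le_sum (f := fun i => ∑ j, entryCLM U V i j A ^ 2)
      (fun _ _ => Finset.sum_nonneg fun _ _ => sq_nonneg _) (Finset.mem_univ i))

theorem norm_le_of_abs_entryCLM_le (hU : U * U.transpose = 1) {A : SymMat n} {c : ℝ}
    (hc : 0 ≤ c) (h : ∀ i j, |entryCLM U U i j A| ≤ c) : ‖A‖ ≤ n * c := by
  refine le_of_sq_le_sq ?_ (by positivity)
  rw [norm_sq_eq_sum_entryCLM hU hU]
  calc ∑ i, ∑ j, entryCLM U U i j A ^ 2 ≤ ∑ _i : Fin n, ∑ _j : Fin n, c ^ 2 :=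
        Finset.sum_le_sum fun i _ => Finset.sum_le_sum fun j _ =>
          sq_le_sq' (abs_le.1 (h i j)).1 (abs_le.1 (h i j)).2
    _ = (n * c) ^ 2 := by simp; ring

theorem sum_entryCLM_mul (hU : U * U.transpose = 1) (A B : SymMat n) (i j : Fin n) :
    ∑ l, entryCLM U U i l A * entryCLM U U l j B =
      (U.transpose * (A.toMatrix * B.toMatrix) * U) i j := by
  have : U.transpose * (A.toMatrix * B.toMatrix) * U =
      (U.transpose * A.toMatrix * U) * (U.transpose * B.toMatrix * U) := by
    calc _ = U.transpose * A.toMatrix * 1 * (B.toMatrix * U) := by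
          rw [mul_one]; simp only [Matrix.mul_assoc]
      _ = _ := by rw [← hU]; simp only [Matrix.mul_assoc]
  rw [this, Matrix.mul_apply]
  rfl

end Coordinates

/-! ### Spectral form of the semidefinite projection. -/

section SpectralProjection

theorem SymMat.exists_eigendecomposition (X : SymMat n) :
    ∃ (U : Matrix (Fin n) (Fin n) ℝ) (l : Fin n → ℝ), U * U.transpose = 1 ∧
      U.transpose * U = 1 ∧ X.toMatrix = U * Matrix.diagonal l * U.transpose := by
  have hX : X.toMatrix.IsHermitian := X.toMatrix_isSymm
  refine ⟨hX.eigenvectorUnitary, hX.eigenvalues, ?_, ?_, ?_⟩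
  · exact (Matrix.mem_unitaryGroup_iff).1 hX.eigenvectorUnitary.2
  · exact (Matrix.mem_unitaryGroup_iff').1 hX.eigenvectorUnitary.2
  · have h := hX.spectral_theorem
    rw [Unitary.conjStarAlgAut_apply] at h
    exact h

variable {U : Matrix (Fin n) (Fin n) ℝ} {l : Fin n → ℝ} {X : SymMat n}

theorem entryCLM_of_eigendecomposition (hU' : U.transpose * U = 1)
    (hX : X.toMatrix = U * Matrix.diagonal l * U.transpose) (i j : Fin n) :
    entryCLM U U i j X = if i = j then l i else 0 := by
  have : U.transpose * X.toMatrix * U = Matrix.diagonal l := by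
    rw [hX]
    calc _ = (U.transpose * U) * Matrix.diagonal l * (U.transpose * U) := by
          simp only [Matrix.mul_assoc]
      _ = _ := by rw [hU', one_mul, mul_one]
  rw [entryCLM_apply, this, Matrix.diagonal_apply]

theorem isSymm_mul_diagonal_mul (U : Matrix (Fin n) (Fin n) ℝ) (l : Fin n → ℝ) :
    (U * Matrix.diagonal l * U.transpose).IsSymm := by
  rw [Matrix.IsSymm]
  simp [Matrix.transpose_mul, Matrix.mul_assoc]

/-- In the eigenbasis `X - Y` is diagonal with nonpositive entries, so pairing it with `Z` sees only
the diagonal of `Uᵀ Z U`, which is nonnegative for semidefinite `Z`. -/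
theorem psd_polar (hU : U * U.transpose = 1) (hU' : U.transpose * U = 1)
    (hX : X.toMatrix = U * Matrix.diagonal l * U.transpose) :
    ∃ Y : SymMat n, Y.toMatrix = U * Matrix.diagonal (fun i => max (l i) 0) * U.transpose ∧
      Y ∈ psdCone n ∧ ⟪X - Y, Y⟫ = 0 ∧ ∀ Z ∈ psdCone n, ⟪X - Y, Z⟫ ≤ 0 := by
  set Y : SymMat n := SymMat.ofMatrix _ (isSymm_mul_diagonal_mul U fun i => max (l i) 0) with hYdef
  have hY : Y.toMatrix = U * Matrix.diagonal (fun i => max (l i) 0) * U.transpose := rfl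
  have hin : ∀ Z : SymMat n, ⟪X - Y, Z⟫ = ∑ i, (l i - max (l i) 0) * entryCLM U U i i Z := by
    intro Z
    rw [inner_eq_sum_entryCLM hU hU]
    refine Finset.sum_congr rfl fun i _ => ?_
    rw [Finset.sum_eq_single i]
    · rw [map_sub, entryCLM_of_eigendecomposition hU' hX, entryCLM_of_eigendecomposition hU' hY]
      simp
    · intro j _ hj
      rw [map_sub, entryCLM_of_eigendecomposition hU' hX, entryCLM_of_eigendecomposition hU' hY]
      simp [hj.symm]
    · simp
  refine ⟨Y, hY, ?_, ?_, ?_⟩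
  · change (Y.toMatrix).PosSemidef
    rw [hY]
    have h1 : (Matrix.diagonal fun i => max (l i) 0).PosSemidef :=
      Matrix.PosSemidef.diagonal fun i => le_max_right _ _
    exact h1.mul_mul_conjTranspose_same U
  · rw [hin]
    refine Finset.sum_eq_zero fun i _ => ?_
    rw [entryCLM_of_eigendecomposition hU' hY, if_pos rfl]
    rcases le_total (l i) 0 with h | h <;> simp [h]
  · intro Z hZ
    rw [hin]
    refine Finset.sum_nonpos fun i _ => mul_nonpos_of_nonpos_of_nonneg (by simp) ?_
    have h1 : (U.transpose * Z.toMatrix * U).PosSemidef :=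
      (show Z.toMatrix.PosSemidef from hZ).conjTranspose_mul_mul_same U
    exact h1.diag_nonneg

/-- The projection onto the positive semidefinite cone keeps the positive part of the spectrum. -/
theorem toMatrix_metricProj_psdCone (hU : U * U.transpose = 1) (hU' : U.transpose * U = 1)
    (hX : X.toMatrix = U * Matrix.diagonal l * U.transpose) :
    (metricProj (psdCone n) X).toMatrix =
      U * Matrix.diagonal (fun i => max (l i) 0) * U.transpose := by
  obtain ⟨Y, hY, hmem, h0, hle⟩ := psd_polar hU hU' hX
  rw [metricProj_eq_of_polar hmem h0 hle, hY]

theorem metricProj_psdCone_spec (X : SymMat n) :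
    metricProj (psdCone n) X ∈ psdCone n ∧
      ⟪X - metricProj (psdCone n) X, metricProj (psdCone n) X⟫ = 0 ∧
      ∀ Z ∈ psdCone n, ⟪X - metricProj (psdCone n) X, Z⟫ ≤ 0 := by
  obtain ⟨U, l, hU, hU', hX⟩ := X.exists_eigendecomposition
  obtain ⟨Y, hY, hmem, h0, hle⟩ := psd_polar hU hU' hX
  rw [metricProj_eq_of_polar hmem h0 hle]
  exact ⟨hmem, h0, hle⟩

theorem isConeProj_psdCone : IsConeProj (metricProj (psdCone n)) where
  inner_self X := (metricProj_psdCone_spec X).2.1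
  inner_le X Y := (metricProj_psdCone_spec X).2.2 _ (metricProj_psdCone_spec Y).1

/-- The negative part of a symmetric matrix. -/
noncomputable def negProj (X : SymMat n) : SymMat n := metricProj (psdCone n) X - X

/-- The algebraic equation behind both local estimates: positive and negative parts have disjoint
spectral supports. -/
theorem psdProj_mul_negProj (X : SymMat n) :
    (metricProj (psdCone n) X).toMatrix * (negProj X).toMatrix = 0 := by
  obtain ⟨U, l, hU, hU', hX⟩ := X.exists_eigendecomposition
  rw [negProj, SymMat.toMatrix_sub, toMatrix_metricProj_psdCone hU hU' hX, hX, mul_sub]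
  have key : ∀ d e : Fin n → ℝ, (U * Matrix.diagonal d * U.transpose) *
      (U * Matrix.diagonal e * U.transpose) =
      U * Matrix.diagonal (fun i => d i * e i) * U.transpose := by
    intro d e
    calc _ = U * Matrix.diagonal d * (U.transpose * U) * Matrix.diagonal e * U.transpose := by
          simp only [Matrix.mul_assoc]
      _ = _ := by rw [hU', mul_one, Matrix.mul_assoc U, Matrix.diagonal_mul_diagonal]
  rw [key, key, sub_eq_zero]
  congr 3
  ext i
  rcases le_total (l i) 0 with h | h <;> simp [h]

theorem sum_entryCLM_psdProj_mul_negProj (hU : U * U.transpose = 1) (X : SymMat n)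
    (i j : Fin n) :
    ∑ k, entryCLM U U i k (metricProj (psdCone n) X) * entryCLM U U k j (negProj X) = 0 := by
  rw [sum_entryCLM_mul hU, psdProj_mul_negProj]
  simp

theorem norm_negProj_sub_le (X Y : SymMat n) : ‖negProj X - negProj Y‖ ≤ ‖X - Y‖ := by
  have h1 := isConeProj_psdCone.norm_sq_le_inner X Y
  have h2 : negProj X - negProj Y = (metricProj (psdCone n) X - metricProj (psdCone n) Y) -
      (X - Y) := by rw [negProj, negProj]; abel
  refine le_of_sq_le_sq ?_ (norm_nonneg _)
  rw [h2, norm_sub_sq_real, real_inner_comm]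
  nlinarith [sq_nonneg ‖metricProj (psdCone n) X - metricProj (psdCone n) Y‖]

variable (hU' : U.transpose * U = 1) (hX : X.toMatrix = U * Matrix.diagonal l * U.transpose)
include hU' hX

theorem entryCLM_psdProj (hU : U * U.transpose = 1) (i j : Fin n) :
    entryCLM U U i j (metricProj (psdCone n) X) = if i = j then max (l i) 0 else 0 :=
  entryCLM_of_eigendecomposition hU' (toMatrix_metricProj_psdCone hU hU' hX) i j

theorem entryCLM_negProj (hU : U * U.transpose = 1) (i j : Fin n) :
    entryCLM U U i j (negProj X) = if i = j then max (-l i) 0 else 0 := by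
  rw [negProj, map_sub, entryCLM_psdProj hU' hX hU, entryCLM_of_eigendecomposition hU' hX]
  split_ifs
  · rcases le_total (l i) 0 with h | h <;> simp [h]
  · simp

end SpectralProjection

/-- Applied to absolute values of eigenvalues, it supplies the gap between 0 and the nonzero
spectrum. -/
theorem exists_pos_le_of_pos {ι : Type*} [Finite ι] (f : ι → ℝ) :
    ∃ g > 0, ∀ k, 0 < f k → g ≤ f k := by
  have h : ∀ᶠ g in 𝓝[>] (0 : ℝ), ∀ k, 0 < f k → g ≤ f k := by
    rw [eventually_all]
    intro k
    by_cases hk : 0 < f k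
    · filter_upwards [mem_nhdsWithin_of_mem_nhds (gt_mem_nhds hk)] with g hg _ using le_of_lt hg
    · exact Eventually.of_forall fun g h => absurd h hk
  obtain ⟨g, hg, hg0⟩ := (h.and self_mem_nhdsWithin).exists
  exact ⟨g, hg0, hg⟩

/-! ### Cubic trapezoidal error for the semidefinite cone. -/

section Trapezoid

/-- Two symmetric perturbations `a`, `b` of complementary diagonal matrices `c`, `d` that keep the
product zero have diagonals that cancel up to third order. -/
theorem abs_sum_diag_le_of_complementary {c d : Fin n → ℝ} {a b : Fin n → Fin n → ℝ} {g h : ℝ}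
    (hg : 0 < g) (hc : ∀ k, c k = 0 ∨ g ≤ c k) (hd : ∀ k, d k = 0 ∨ g ≤ d k)
    (hcd : ∀ k, c k = 0 ∨ d k = 0) (ha : ∀ k m, a k m = a m k) (hb : ∀ k m, b k m = b m k)
    (hah : ∀ k m, |a k m| ≤ h) (hbh : ∀ k m, |b k m| ≤ h)
    (hrel : ∀ k m, c k * b k m + a k m * d m + ∑ l, a k l * b l m = 0) :
    |∑ k, (c k * b k k - d k * a k k)| ≤ n ^ 3 / g * h ^ 3 := by
  classical
  have hquad : ∀ k m, |∑ l, a k l * b l m| ≤ n * h ^ 2 := by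
    intro k m
    refine (Finset.abs_sum_le_sum_abs _ _).trans ?_
    calc ∑ l, |a k l * b l m| ≤ ∑ _l : Fin n, h ^ 2 := Finset.sum_le_sum fun l _ => by
          rw [abs_mul, sq]
          exact mul_le_mul (hah _ _) (hbh _ _) (abs_nonneg _) ((abs_nonneg _).trans (hah k l))
      _ = n * h ^ 2 := by simp
  have hbsmall : ∀ k m, g ≤ c k → d m = 0 → |b k m| ≤ n * h ^ 2 / g := by
    intro k m hk hm
    have h1 := hrel k m
    rw [hm, mul_zero, add_zero] at h1
    have h2 : c k * |b k m| ≤ n * h ^ 2 := by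
      rw [← abs_of_pos (hg.trans_le hk), ← abs_mul, eq_neg_of_add_eq_zero_left h1, abs_neg]
      exact hquad k m
    rw [le_div_iff₀ hg, mul_comm]
    exact (mul_le_mul_of_nonneg_right hk (abs_nonneg _)).trans h2
  have hasmall : ∀ k m, c k = 0 → g ≤ d m → |a k m| ≤ n * h ^ 2 / g := by
    intro k m hk hm
    have h1 := hrel k m
    rw [hk, zero_mul, zero_add] at h1
    have h2 : |a k m| * d m ≤ n * h ^ 2 := by
      rw [← abs_of_pos (hg.trans_le hm), ← abs_mul, eq_neg_of_add_eq_zero_left h1, abs_neg]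
      exact hquad k m
    rw [le_div_iff₀ hg]
    exact (mul_le_mul_of_nonneg_left hm (abs_nonneg _)).trans h2
  -- The sign of the `k`-th eigenvalue; the diagonal case of `hrel` makes each summand `-s k` times
  -- a row sum of products `a k l * b k l`.
  set s : Fin n → ℝ := fun k => if 0 < c k then 1 else if 0 < d k then -1 else 0 with hs
  have hsign : ∀ k, (s k = 1 ∧ g ≤ c k ∧ d k = 0) ∨ (s k = -1 ∧ c k = 0 ∧ g ≤ d k) ∨
      (s k = 0 ∧ c k = 0 ∧ d k = 0) := by
    intro k
    rcases hc k with h0 | h1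
    · rcases hd k with h2 | h3
      · simp [hs, h0, h2]
      · simp [hs, h0, h3, hg.trans_le h3]
    · rcases hcd k with h2 | h2
      · linarith
      · simp [hs, h1, h2, hg.trans_le h1]
  have hdiag : ∀ k, c k * b k k - d k * a k k = - ∑ l, s k * (a k l * b k l) := by
    intro k
    have h1 := hrel k k
    have h2 : ∑ l, a k l * b l k = ∑ l, a k l * b k l :=
      Finset.sum_congr rfl fun l _ => by rw [hb l k]
    rw [h2] at h1
    rw [← Finset.mul_sum]
    rcases hsign k with ⟨e, -, e2⟩ | ⟨e, e1, -⟩ | ⟨e, e1, e2⟩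
    · rw [e2] at h1 ⊢; rw [e]; linarith
    · rw [e1] at h1 ⊢; rw [e]; linarith
    · rw [e, e1, e2]; ring
  -- Symmetrizing in `k, l` cancels the pairs of opposite sign, where neither factor need be of
  -- second order. In any other pair with `s k + s l ≠ 0` one factor is `O(h²)`.
  have hsum : ∑ k, (c k * b k k - d k * a k k) =
      - (1 / 2) * ∑ k, ∑ l, (s k + s l) * (a k l * b k l) := by
    have h1 : ∑ k, (c k * b k k - d k * a k k) = - ∑ k, ∑ l, s k * (a k l * b k l) := by
      rw [← Finset.sum_neg_distrib]
      exact Finset.sum_congr rfl fun k _ => hdiag k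
    have h2 : ∑ k, ∑ l, s l * (a k l * b k l) = ∑ k, ∑ l, s k * (a k l * b k l) := by
      rw [Finset.sum_comm]
      exact Finset.sum_congr rfl fun k _ => Finset.sum_congr rfl fun l _ => by
        rw [ha l k, hb l k]
    simp only [add_mul, Finset.sum_add_distrib]
    rw [h2, h1]; ring
  have hterm : ∀ k l, |(s k + s l) * (a k l * b k l)| ≤ 2 * (n * h ^ 2 / g * h) := by
    intro k l
    have h0 : 0 ≤ h := (abs_nonneg _).trans (hah k l)
    have hn : 0 ≤ n * h ^ 2 / g := by positivity
    have hA : |a k l| ≤ n * h ^ 2 / g → |a k l * b k l| ≤ n * h ^ 2 / g * h := fun h1 => by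
      rw [abs_mul]; exact mul_le_mul h1 (hbh k l) (abs_nonneg _) hn
    have hB : |b k l| ≤ n * h ^ 2 / g → |a k l * b k l| ≤ n * h ^ 2 / g * h := fun h1 => by
      rw [abs_mul, mul_comm]; exact mul_le_mul h1 (hah k l) (abs_nonneg _) hn
    have hkey : s k + s l = 0 ∨ |a k l * b k l| ≤ n * h ^ 2 / g * h := by
      rcases hsign k with ⟨e, e1, e2⟩ | ⟨e, e1, e2⟩ | ⟨e, e1, e2⟩ <;>
        rcases hsign l with ⟨e', e1', e2'⟩ | ⟨e', e1', e2'⟩ | ⟨e', e1', e2'⟩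
      · exact Or.inr (hB (hbsmall k l e1 e2'))
      · left; rw [e, e']; ring
      · exact Or.inr (hB (hbsmall k l e1 e2'))
      · left; rw [e, e']; ring
      · exact Or.inr (hA (hasmall k l e1 e2'))
      · exact Or.inr (hA (ha k l ▸ hasmall l k e1' e2))
      · exact Or.inr (hB (hb k l ▸ hbsmall l k e1' e2))
      · exact Or.inr (hA (hasmall k l e1 e2'))
      · left; rw [e, e']; ring
    have hs2 : |s k + s l| ≤ 2 := by
      have : ∀ k, |s k| ≤ 1 := fun k => by
        rcases hsign k with ⟨e, -⟩ | ⟨e, -⟩ | ⟨e, -⟩ <;> rw [e] <;> norm_num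
      exact (abs_add_le _ _).trans (by linarith [this k, this l])
    rcases hkey with h1 | h1
    · rw [h1, zero_mul, abs_zero]; positivity
    · rw [abs_mul]
      exact mul_le_mul hs2 h1 (abs_nonneg _) two_pos.le
  rw [hsum, abs_mul]
  have hle : |∑ k, ∑ l, (s k + s l) * (a k l * b k l)| ≤ n * (n * (2 * (n * h ^ 2 / g * h))) := by
    calc _ ≤ ∑ k, |∑ l, (s k + s l) * (a k l * b k l)| := Finset.abs_sum_le_sum_abs _ _
      _ ≤ ∑ k, ∑ l, |(s k + s l) * (a k l * b k l)| :=
          Finset.sum_le_sum fun k _ => Finset.abs_sum_le_sum_abs _ _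
      _ ≤ ∑ _k : Fin n, ∑ _l : Fin n, 2 * (n * h ^ 2 / g * h) :=
          Finset.sum_le_sum fun k _ => Finset.sum_le_sum fun l _ => hterm k l
      _ = _ := by simp
  have habs : |(-(1 / 2) : ℝ)| = 1 / 2 := by norm_num
  rw [habs]
  calc _ ≤ 1 / 2 * (n * (n * (2 * (n * h ^ 2 / g * h)))) :=
        mul_le_mul_of_nonneg_left hle (by norm_num)
    _ = n ^ 3 / g * h ^ 3 := by ring

/-- By homogeneity this skew difference is, up to a factor, the trapezoidal error of `½‖P ·‖²`. In
the eigenbasis of `X` only diagonal increments of `P` and `negProj` enter, and expanding `P(Y) N(Y)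
= 0` controls them. -/
theorem psdProj_trapezoid (X : SymMat n) : ∃ C, ∀ Y : SymMat n,
    |⟪metricProj (psdCone n) Y, X⟫ - ⟪metricProj (psdCone n) X, Y⟫| ≤ C * ‖Y - X‖ ^ 3 := by
  obtain ⟨U, l, hU, hU', hX⟩ := X.exists_eigendecomposition
  obtain ⟨g, hg, hgl⟩ := exists_pos_le_of_pos fun k => |l k|
  refine ⟨n ^ 3 / g, fun Y => ?_⟩
  set P : SymMat n → SymMat n := metricProj (psdCone n) with hP
  have hXm : X = P X - negProj X := by rw [negProj]; abel
  have hYm : Y = P Y - negProj Y := by rw [negProj]; abel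
  have hPX := entryCLM_psdProj hU' hX hU
  have hNX := entryCLM_negProj hU' hX hU
  have hpos : ∀ k, max (l k) 0 = 0 ∨ g ≤ max (l k) 0 := fun k => by
    rcases le_or_gt (l k) 0 with h | h
    · left; exact max_eq_right h
    · right; rw [max_eq_left h.le]
      have := hgl k (abs_pos.2 h.ne')
      rwa [abs_of_pos h] at this
  have hneg : ∀ k, max (-l k) 0 = 0 ∨ g ≤ max (-l k) 0 := fun k => by
    rcases le_or_gt (-l k) 0 with h | h
    · left; exact max_eq_right h
    · right; rw [max_eq_left h.le]
      have := hgl k (abs_pos.2 (by linarith : l k < 0).ne)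
      rwa [abs_of_neg (by linarith)] at this
  have hcomp : ∀ k, max (l k) 0 = 0 ∨ max (-l k) 0 = 0 := fun k => by
    rcases le_total (l k) 0 with h | h
    · left; exact max_eq_right h
    · right; exact max_eq_right (by linarith)
  have hinP : ∀ Z : SymMat n, ⟪P X, Z⟫ = ∑ k, max (l k) 0 * entryCLM U U k k Z := fun Z => by
    rw [inner_eq_sum_entryCLM hU hU]
    refine Finset.sum_congr rfl fun k _ => ?_
    rw [Finset.sum_eq_single k]
    · rw [hPX, if_pos rfl]
    · intro j _ hj; rw [hPX, if_neg hj.symm, zero_mul]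
    · simp
  have hinN : ∀ Z : SymMat n, ⟪negProj X, Z⟫ = ∑ k, max (-l k) 0 * entryCLM U U k k Z :=
    fun Z => by
      rw [inner_eq_sum_entryCLM hU hU]
      refine Finset.sum_congr rfl fun k _ => ?_
      rw [Finset.sum_eq_single k]
      · rw [hNX, if_pos rfl]
      · intro j _ hj; rw [hNX, if_neg hj.symm, zero_mul]
      · simp
  have hT : ⟪P Y, X⟫ - ⟪P X, Y⟫ = ∑ k, (max (l k) 0 * entryCLM U U k k (negProj Y - negProj X) -
      max (-l k) 0 * entryCLM U U k k (P Y - P X)) := by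
    have e1 : ⟪P Y, X⟫ - ⟪P X, Y⟫ = ⟪P X, negProj Y - negProj X⟫ - ⟪negProj X, P Y - P X⟫ := by
      have h0 : ⟪P X, negProj X⟫ = 0 := by
        have := isConeProj_psdCone.inner_self X
        rw [negProj, ← neg_sub X, inner_neg_right, real_inner_comm, this, neg_zero]
      have h1 : ⟪P Y, X⟫ = ⟪P Y, P X⟫ - ⟪P Y, negProj X⟫ := by
        rw [← inner_sub_right, ← hXm]
      have h2 : ⟪P X, Y⟫ = ⟪P X, P Y⟫ - ⟪P X, negProj Y⟫ := by
        rw [← inner_sub_right, ← hYm]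
      rw [h1, h2, inner_sub_right, inner_sub_right, h0, real_inner_comm (P X) (negProj X), h0,
        real_inner_comm (P X) (P Y), real_inner_comm (negProj X) (P Y)]
      ring
    rw [e1, hinP, hinN, Finset.sum_sub_distrib]
  rw [hT]
  refine abs_sum_diag_le_of_complementary
    (a := fun i j => entryCLM U U i j (P Y - P X))
    (b := fun i j => entryCLM U U i j (negProj Y - negProj X)) hg hpos hneg hcomp
    (fun _ _ => entryCLM_comm _ _ _) (fun _ _ => entryCLM_comm _ _ _)
    (fun i j => (abs_entryCLM_le hU hU _ i j).trans (isConeProj_psdCone.norm_sub_le _ _))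
    (fun i j => (abs_entryCLM_le hU hU _ i j).trans (norm_negProj_sub_le _ _)) ?_
  intro k m
  have h1 := sum_entryCLM_psdProj_mul_negProj hU Y k m
  have h2 := sum_entryCLM_psdProj_mul_negProj hU X k m
  have h3 : ∑ j, entryCLM U U k j (P X) * entryCLM U U j m (negProj Y) =
      max (l k) 0 * entryCLM U U k m (negProj Y) := by
    rw [Finset.sum_eq_single k]
    · rw [hPX, if_pos rfl]
    · intro j _ hj; rw [hPX, if_neg hj.symm, zero_mul]
    · simp
  have h4 : ∑ j, entryCLM U U k j (P Y) * entryCLM U U j m (negProj X) =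
      entryCLM U U k m (P Y) * max (-l m) 0 := by
    rw [Finset.sum_eq_single m]
    · rw [hNX, if_pos rfl]
    · intro j _ hj; rw [hNX, if_neg hj, mul_zero]
    · simp
  have h5 : max (l k) 0 * entryCLM U U k m (negProj X) = 0 := by
    rw [hNX]
    split_ifs
    · rcases hcomp k with h | h
      · rw [h, zero_mul]
      · rw [h, mul_zero]
    · simp
  have h6 : entryCLM U U k m (P X) * max (-l m) 0 = 0 := by
    rw [hPX]
    split_ifs with h
    · subst h
      rcases hcomp k with h | h
      · rw [h, zero_mul]
      · rw [h, mul_zero]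
    · simp
  simp only [map_sub, mul_sub, sub_mul, Finset.sum_sub_distrib]
  rw [h1, h2, h3, h4, h5, h6]
  ring

end Trapezoid

/-! ### Strong semismoothness of the semidefinite projection. -/

section Semismooth

variable {U V : Matrix (Fin n) (Fin n) ℝ} {l m : Fin n → ℝ} {X Y : SymMat n}

/-- Moving a zero eigenvalue along its eigenprojection makes an entry of the projection equal to
`max t 0`, which has a kink. -/
theorem eigenvalue_ne_zero_of_differentiableAt (hU : U * U.transpose = 1)
    (hU' : U.transpose * U = 1) (hY : Y.toMatrix = U * Matrix.diagonal l * U.transpose)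
    (hd : DifferentiableAt ℝ (metricProj (psdCone n)) Y) (i : Fin n) : l i ≠ 0 := by
  intro hi
  set K : SymMat n := SymMat.ofMatrix _ (isSymm_mul_diagonal_mul U (Pi.single i 1)) with hK
  have hKm : K.toMatrix = U * Matrix.diagonal (Pi.single i 1) * U.transpose := rfl
  have hline : ∀ t : ℝ, (Y + t • K).toMatrix =
      U * Matrix.diagonal (l + t • Pi.single i 1) * U.transpose := by
    intro t
    have h : Matrix.diagonal (l + t • Pi.single i 1) =
        Matrix.diagonal l + t • Matrix.diagonal (Pi.single i 1) := by
      rw [← Matrix.diagonal_smul, Matrix.diagonal_add]; rfl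
    rw [SymMat.toMatrix_add, SymMat.toMatrix_smul, hY, hKm, h, mul_add, add_mul]
    simp
  have h1 : ∀ t : ℝ, entryCLM U U i i (metricProj (psdCone n) (Y + t • K)) = max t 0 := by
    intro t
    rw [entryCLM_psdProj hU' (hline t) hU]
    simp [hi]
  have h2 : HasDerivAt (fun t : ℝ => metricProj (psdCone n) (Y + t • K)) _ 0 :=
    hd.hasFDerivAt.hasLineDerivAt K
  have h3 := (entryCLM U U i i).hasFDerivAt.comp_hasDerivAt (0 : ℝ) h2
  have h4 : DifferentiableAt ℝ (fun t : ℝ => 2 * max t 0 - t) 0 := by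
    have : DifferentiableAt ℝ (fun t : ℝ => max t 0) 0 := by
      refine (h3.congr_of_eventuallyEq (Eventually.of_forall fun t => ?_)).differentiableAt
      exact (h1 t).symm
    fun_prop
  refine not_differentiableAt_abs_zero (h4.congr_of_eventuallyEq (Eventually.of_forall fun t => ?_))
  rcases le_total t 0 with h | h
  · simp [h, abs_of_nonpos h]
  · simp [h, abs_of_nonneg h]; ring

/-- Differentiating the complementarity relation `P(Y) (P(Y) - Y) = 0`. -/
theorem entryCLM_fderiv_psdProj (hU : U * U.transpose = 1)
    (hU' : U.transpose * U = 1) (hY : Y.toMatrix = U * Matrix.diagonal l * U.transpose)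
    (hd : DifferentiableAt ℝ (metricProj (psdCone n)) Y) (Z : SymMat n) (i j : Fin n) :
    max (l i) 0 * (entryCLM U U i j (fderiv ℝ (metricProj (psdCone n)) Y Z) -
      entryCLM U U i j Z) +
      entryCLM U U i j (fderiv ℝ (metricProj (psdCone n)) Y Z) * max (-l j) 0 = 0 := by
  set P : SymMat n → SymMat n := metricProj (psdCone n) with hP
  set W := fderiv ℝ P Y Z
  have h1 : HasDerivAt (fun t : ℝ => P (Y + t • Z)) W 0 := hd.hasFDerivAt.hasLineDerivAt Z
  have h2 : HasDerivAt (fun t : ℝ => negProj (Y + t • Z)) (W - Z) 0 := by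
    have h : HasDerivAt (fun t : ℝ => Y + t • Z) Z 0 := by
      simpa using ((hasDerivAt_id (0 : ℝ)).smul_const Z).const_add Y
    exact h1.sub h
  have h3 : ∀ a b, HasDerivAt (fun t : ℝ => entryCLM U U a b (P (Y + t • Z)))
      (entryCLM U U a b W) 0 := fun a b => (entryCLM U U a b).hasFDerivAt.comp_hasDerivAt _ h1
  have h4 : ∀ a b, HasDerivAt (fun t : ℝ => entryCLM U U a b (negProj (Y + t • Z)))
      (entryCLM U U a b (W - Z)) 0 :=
    fun a b => (entryCLM U U a b).hasFDerivAt.comp_hasDerivAt _ h2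
  have h5 := HasDerivAt.fun_sum (u := Finset.univ) fun k (_ : k ∈ Finset.univ) =>
    (h3 i k).mul (h4 k j)
  have h6 : (fun t : ℝ => ∑ k, entryCLM U U i k (P (Y + t • Z)) *
      entryCLM U U k j (negProj (Y + t • Z))) = fun _ => 0 :=
    funext fun t => sum_entryCLM_psdProj_mul_negProj hU _ i j
  have h7 := (h6 ▸ h5 : HasDerivAt (fun _ : ℝ => (0 : ℝ)) _ 0).unique (hasDerivAt_const 0 0)
  simp only [zero_smul, add_zero, Finset.sum_add_distrib] at h7
  rw [Finset.sum_eq_single j, Finset.sum_eq_single i] at h7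
  · rw [entryCLM_psdProj hU' hY hU, entryCLM_negProj hU' hY hU, if_pos rfl, if_pos rfl,
      map_sub] at h7
    linarith
  · intro k _ hk; rw [entryCLM_psdProj hU' hY hU, if_neg hk.symm, zero_mul]
  · simp
  · intro k _ hk; rw [entryCLM_negProj hU' hY hU, if_neg hk, mul_zero]
  · simp

theorem entryCLM_eq_sum_of_eigendecomposition
    (hX : X.toMatrix = V * Matrix.diagonal m * V.transpose) (i j : Fin n) :
    entryCLM U U i j X = ∑ k, m k * ((V.transpose * U) k i * (V.transpose * U) k j) := by
  have h : U.transpose * X.toMatrix * U =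
      (V.transpose * U).transpose * Matrix.diagonal m * (V.transpose * U) := by
    rw [hX, Matrix.transpose_mul, Matrix.transpose_transpose]
    simp only [Matrix.mul_assoc]
  rw [entryCLM_apply, h, Matrix.mul_apply]
  refine Finset.sum_congr rfl fun k _ => ?_
  rw [Matrix.mul_diagonal, Matrix.transpose_apply]
  ring

/-- Eigenvectors of `Y` for small eigenvalues are nearly orthogonal to the range of a nearby `X`. -/
theorem abs_overlap_le (hU : U * U.transpose = 1) (hU' : U.transpose * U = 1)
    (hV : V * V.transpose = 1) (hV' : V.transpose * V = 1)
    (hY : Y.toMatrix = U * Matrix.diagonal l * U.transpose)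
    (hX : X.toMatrix = V * Matrix.diagonal m * V.transpose) {g : ℝ} (hg : 0 < g) {k i : Fin n}
    (hk : g ≤ |m k|) (hi : |l i| < g / 2) :
    |(V.transpose * U) k i| ≤ 2 / g * ‖Y - X‖ := by
  -- Entrywise this is `(l i - m k)` times the overlap, and `|l i - m k| ≥ g / 2`.
  have h1 : V.transpose * (Y - X).toMatrix * U =
      (V.transpose * U) * Matrix.diagonal l - Matrix.diagonal m * (V.transpose * U) := by
    rw [SymMat.toMatrix_sub, mul_sub, sub_mul, hY, hX]
    congr 1
    · calc _ = V.transpose * U * Matrix.diagonal l * (U.transpose * U) := by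
            simp only [Matrix.mul_assoc]
        _ = _ := by rw [hU', mul_one]
    · calc _ = (V.transpose * V) * Matrix.diagonal m * (V.transpose * U) := by
            simp only [Matrix.mul_assoc]
        _ = _ := by rw [hV', one_mul]
  have h2 := abs_entryCLM_le hV hU (Y - X) k i
  rw [entryCLM_apply, h1, Matrix.sub_apply, Matrix.mul_diagonal, Matrix.diagonal_mul,
    mul_comm (m k), ← mul_sub, abs_mul] at h2
  have h3 : g / 2 ≤ |l i - m k| := by
    have := abs_sub_abs_le_abs_sub (m k) (l i)
    rw [abs_sub_comm] at this
    linarith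
  have h4 := (mul_le_mul_of_nonneg_left h3 (abs_nonneg ((V.transpose * U) k i))).trans h2
  rw [div_mul_eq_mul_div, le_div_iff₀ hg]
  linarith

/-- Euler's identity reduces the error to `P'(Y) X - P X`, estimated entrywise in the eigenbasis of
`Y`. The constant depends on `X` alone, although the eigenvalues of `Y` may be arbitrarily small. -/
theorem psdProj_quadratic_estimate (X : SymMat n) : ∃ C, ∀ Y : SymMat n,
    DifferentiableAt ℝ (metricProj (psdCone n)) Y →
    ‖metricProj (psdCone n) Y - metricProj (psdCone n) X -
      fderiv ℝ (metricProj (psdCone n)) Y (Y - X)‖ ≤ C * ‖Y - X‖ ^ 2 := by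
  obtain ⟨V, m, hV, hV', hX⟩ := X.exists_eigendecomposition
  obtain ⟨g, hg, hgm⟩ := exists_pos_le_of_pos fun k => |m k|
  set S := ∑ k, |m k| with hS
  have hS0 : 0 ≤ S := Finset.sum_nonneg fun _ _ => abs_nonneg _
  set c := 4 * n / g + 2 * (S * (2 / g) ^ 2) with hc
  have hc0 : 0 ≤ c := by positivity
  refine ⟨n * c, fun Y hd => ?_⟩
  obtain ⟨U, l, hU, hU', hY⟩ := Y.exists_eigendecomposition
  set P : SymMat n → SymMat n := metricProj (psdCone n) with hP
  set h := ‖Y - X‖ with hh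
  set W := fderiv ℝ P Y X with hW
  have hE : P Y - P X - fderiv ℝ P Y (Y - X) = W - P X := by
    rw [map_sub, isConeProj_psdCone.fderiv_self hd]; abel
  have hrel := entryCLM_fderiv_psdProj hU hU' hY hd X
  have hPY := entryCLM_psdProj hU' hY hU
  have hNY := entryCLM_negProj hU' hY hU
  have habs : ∀ t : ℝ, max t 0 + max (-t) 0 = |t| := fun t => by
    rcases le_total t 0 with h | h
    · simp [h, abs_of_nonpos h]
    · simp [h, abs_of_nonneg h]
  rw [hE, mul_assoc]
  refine norm_le_of_abs_entryCLM_le hU (by positivity) fun i j => ?_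
  rw [map_sub]
  have hli := eigenvalue_ne_zero_of_differentiableAt hU hU' hY hd i
  have hWs := entryCLM_comm (U := U) W i j
  have hXs := entryCLM_comm (U := U) X i j
  have hPs := entryCLM_comm (U := U) (P X) i j
  have hli0 : 0 < |l i| := abs_pos.2 hli
  -- If both eigenvalues are small, both eigenvectors are `O(h)`-orthogonal to the range of `X`, so
  -- the entries of `X`, `P X` and `W` are separately `O(h²)`. Otherwise one may divide by `|l i| +
  -- |l j|`.
  by_cases hsmall : |l i| < g / 2 ∧ |l j| < g / 2
  · have hbound : ∀ (Z : SymMat n) (m' : Fin n → ℝ), (∀ k, |m' k| ≤ |m k|) →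
        Z.toMatrix = V * Matrix.diagonal m' * V.transpose →
        |entryCLM U U i j Z| ≤ S * (2 / g) ^ 2 * h ^ 2 := by
      intro Z m' hm' hZ
      rw [entryCLM_eq_sum_of_eigendecomposition hZ]
      refine (Finset.abs_sum_le_sum_abs _ _).trans ?_
      rw [mul_assoc, hS, Finset.sum_mul]
      refine Finset.sum_le_sum fun k _ => ?_
      rw [abs_mul]
      rcases eq_or_ne (m k) 0 with hk | hk
      · have := hm' k
        rw [hk, abs_zero] at this
        rw [le_antisymm this (abs_nonneg _), hk]; simp
      · have hk' := hgm k (abs_pos.2 hk)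
        have e1 := abs_overlap_le hU hU' hV hV' hY hX hg hk' hsmall.1
        have e2 := abs_overlap_le hU hU' hV hV' hY hX hg hk' hsmall.2
        refine mul_le_mul (hm' k) ?_ (abs_nonneg _) (abs_nonneg _)
        rw [abs_mul, ← mul_pow, sq]
        exact mul_le_mul e1 e2 (abs_nonneg _) (by positivity)
    have hb1 := hbound X m (fun _ => le_rfl) hX
    have hb2 := hbound (P X) (fun k => max (m k) 0) (fun k => by
      rw [abs_of_nonneg (le_max_right _ _)]
      exact max_le (le_abs_self _) (abs_nonneg _)) (toMatrix_metricProj_psdCone hV hV' hX)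
    -- Adding the derivative relations at `(i, j)` and `(j, i)` shows that `W` is an entrywise
    -- multiple of `X` with factor in `[0, 1]`; nonsingularity of `Y` permits the division.
    have hb3 : |entryCLM U U i j W| ≤ |entryCLM U U i j X| := by
      have e1 := hrel i j
      have e2 := hrel j i
      rw [← hXs, ← hW, ← hWs] at e2
      rw [← hW] at e1
      have e3 : (|l i| + |l j|) * entryCLM U U i j W =
          (max (l i) 0 + max (l j) 0) * entryCLM U U i j X := by
        rw [← habs, ← habs]; linarith
      have e4 : (|l i| + |l j|) * |entryCLM U U i j W| ≤
          (|l i| + |l j|) * |entryCLM U U i j X| := by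
        have hp : 0 < |l i| + |l j| := by positivity
        nth_rewrite 1 [← abs_of_pos hp]
        rw [← abs_mul, e3, abs_mul]
        refine mul_le_mul_of_nonneg_right ?_ (abs_nonneg _)
        rw [abs_of_nonneg (by positivity)]
        exact add_le_add (max_le (le_abs_self _) (abs_nonneg _))
          (max_le (le_abs_self _) (abs_nonneg _))
      exact le_of_mul_le_mul_left e4 (by positivity)
    refine (abs_sub _ _).trans ?_
    have : 0 ≤ 4 * n / g * h ^ 2 := by positivity
    rw [hc, add_mul]
    linarith
  · have hlarge : g / 2 ≤ |l i| + |l j| := by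
      by_contra! hlt
      exact hsmall ⟨by linarith [abs_nonneg (l j)], by linarith [abs_nonneg (l i)]⟩
    -- The left side is exactly an entry of `(P Y - P X)(N Y - N X)`, a product of two increments of
    -- size `h`.
    have hR : ∀ i j, |(max (l i) 0 + max (-l j) 0) *
        (entryCLM U U i j W - entryCLM U U i j (P X))| ≤ n * h ^ 2 := by
      intro i j
      have e1 := hrel i j
      have e2 := sum_entryCLM_psdProj_mul_negProj hU Y i j
      have e3 := sum_entryCLM_psdProj_mul_negProj hU X i j
      have e4 : ∑ k, entryCLM U U i k (P Y) * entryCLM U U k j (negProj X) =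
          max (l i) 0 * entryCLM U U i j (negProj X) := by
        rw [Finset.sum_eq_single i]
        · rw [hPY, if_pos rfl]
        · intro k _ hk; rw [hPY, if_neg hk.symm, zero_mul]
        · simp
      have e5 : ∑ k, entryCLM U U i k (P X) * entryCLM U U k j (negProj Y) =
          entryCLM U U i j (P X) * max (-l j) 0 := by
        rw [Finset.sum_eq_single j]
        · rw [hNY, if_pos rfl]
        · intro k _ hk; rw [hNY, if_neg hk, mul_zero]
        · simp
      have e6 : (max (l i) 0 + max (-l j) 0) *
          (entryCLM U U i j W - entryCLM U U i j (P X)) =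
          ∑ k, entryCLM U U i k (P Y - P X) * entryCLM U U k j (negProj Y - negProj X) := by
        simp only [map_sub, mul_sub, sub_mul, Finset.sum_sub_distrib]
        rw [e2, e3, e4, e5, negProj, map_sub]
        rw [← hW] at e1
        linarith
      rw [e6]
      refine (Finset.abs_sum_le_sum_abs _ _).trans ?_
      calc _ ≤ ∑ _k : Fin n, h ^ 2 := Finset.sum_le_sum fun k _ => by
            rw [abs_mul, sq]
            exact mul_le_mul
              ((abs_entryCLM_le hU hU _ _ _).trans (isConeProj_psdCone.norm_sub_le _ _))
              ((abs_entryCLM_le hU hU _ _ _).trans (norm_negProj_sub_le _ _))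
              (abs_nonneg _) (norm_nonneg _)
        _ = n * h ^ 2 := by simp
    have e1 := hR i j
    have e2 := hR j i
    rw [← hWs, ← hPs] at e2
    set e := entryCLM U U i j W - entryCLM U U i j (P X)
    have e3 : (|l i| + |l j|) * |e| ≤ 2 * (n * h ^ 2) := by
      have hp : 0 < |l i| + |l j| := by positivity
      nth_rewrite 1 [← abs_of_pos hp]
      rw [← abs_mul, ← habs (l i), ← habs (l j)]
      have : (max (l i) 0 + max (-l i) 0 + (max (l j) 0 + max (-l j) 0)) * e =
          (max (l i) 0 + max (-l j) 0) * e + (max (l j) 0 + max (-l i) 0) * e := by ring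
      rw [this]
      exact (abs_add_le _ _).trans (by linarith)
    have e4 := (mul_le_mul_of_nonneg_right hlarge (abs_nonneg e)).trans e3
    have e5 : |e| ≤ 4 * n / g * h ^ 2 := by
      rw [div_mul_eq_mul_div, le_div_iff₀ hg]; linarith
    have : 0 ≤ 2 * (S * (2 / g) ^ 2) * h ^ 2 := by positivity
    rw [hc, add_mul]
    linarith

end Semismooth

/-! ### The entrywise nonnegative cone. -/

section Nonneg

theorem metricProj_nonnegCone_spec (X : SymMat n) :
    (∀ p, (metricProj (nonnegCone n) X).1 p = max (X.1 p) 0) ∧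
      ⟪X - metricProj (nonnegCone n) X, metricProj (nonnegCone n) X⟫ = 0 ∧
      ∀ Z ∈ nonnegCone n, ⟪X - metricProj (nonnegCone n) X, Z⟫ ≤ 0 := by
  set Y : SymMat n := SymMat.ofMatrix (Matrix.of fun i j => max (X.1 (i, j)) 0) (by
    ext i j; simp [X.2 i j]) with hY
  have hYp : ∀ p, Y.1 p = max (X.1 p) 0 := fun p => rfl
  have hin : ∀ Z : SymMat n, ⟪X - Y, Z⟫ = ∑ p, (X.1 p - max (X.1 p) 0) * Z.1 p := fun Z => by
    rw [Submodule.coe_inner, PiLp.inner_apply]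
    refine Finset.sum_congr rfl fun p _ => ?_
    rw [← hYp]
    simp [mul_comm]
  have h0 : ⟪X - Y, Y⟫ = 0 := by
    rw [hin]
    refine Finset.sum_eq_zero fun p _ => ?_
    rw [hYp]
    rcases le_total (X.1 p) 0 with h | h <;> simp [h]
  have hle : ∀ Z ∈ nonnegCone n, ⟪X - Y, Z⟫ ≤ 0 := fun Z hZ => by
    rw [hin]
    exact Finset.sum_nonpos fun p _ =>
      mul_nonpos_of_nonpos_of_nonneg (by simp) (hZ p.1 p.2)
  have hmem : Y ∈ nonnegCone n := fun i j => le_max_right _ _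
  rw [metricProj_eq_of_polar hmem h0 hle]
  exact ⟨hYp, h0, hle⟩

theorem isConeProj_nonnegCone : IsConeProj (metricProj (nonnegCone n)) where
  inner_self X := (metricProj_nonnegCone_spec X).2.1
  inner_le X Y := (metricProj_nonnegCone_spec X).2.2 _ fun i j => by
    change 0 ≤ (metricProj (nonnegCone n) Y).1 (i, j)
    rw [(metricProj_nonnegCone_spec Y).1]
    exact le_max_right _ _

theorem eventually_same_sign (X : SymMat n) : ∀ᶠ Y : SymMat n in 𝓝 X, ∀ p,
    X.1 p = 0 ∨ (0 < X.1 p ∧ 0 < Y.1 p) ∨ (X.1 p < 0 ∧ Y.1 p < 0) := by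
  rw [eventually_all]
  intro p
  have hcont : Tendsto (fun Y : SymMat n => Y.1 p) (𝓝 X) (𝓝 (X.1 p)) :=
    Continuous.tendsto (by fun_prop) X
  rcases lt_trichotomy (X.1 p) 0 with h | h | h
  · filter_upwards [hcont.eventually (gt_mem_nhds h)] with Y hY using Or.inr (Or.inr ⟨h, hY⟩)
  · exact Eventually.of_forall fun _ => Or.inl h
  · filter_upwards [hcont.eventually (lt_mem_nhds h)] with Y hY using Or.inr (Or.inl ⟨h, hY⟩)

theorem nonnegProj_trapezoid (X : SymMat n) : ∀ᶠ Y : SymMat n in 𝓝 X,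
    ⟪metricProj (nonnegCone n) Y, X⟫ = ⟪metricProj (nonnegCone n) X, Y⟫ := by
  filter_upwards [eventually_same_sign X] with Y hY
  rw [Submodule.coe_inner, Submodule.coe_inner, PiLp.inner_apply, PiLp.inner_apply]
  refine Finset.sum_congr rfl fun p _ => ?_
  rw [(metricProj_nonnegCone_spec X).1, (metricProj_nonnegCone_spec Y).1]
  rcases hY p with h | ⟨h, h'⟩ | ⟨h, h'⟩
  · simp [h]
  · simp [h.le, h'.le, mul_comm]
  · simp [h.le, h'.le]

/-- Near `X` the Jacobian of the projection onto the nonnegative matrices is exact in the direction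
of `X`. -/
theorem nonnegProj_fderiv_eq (X : SymMat n) : ∀ᶠ Y : SymMat n in 𝓝 X,
    DifferentiableAt ℝ (metricProj (nonnegCone n)) Y →
    fderiv ℝ (metricProj (nonnegCone n)) Y (Y - X) =
      metricProj (nonnegCone n) Y - metricProj (nonnegCone n) X := by
  filter_upwards [eventually_same_sign X] with Y hY hd
  set P : SymMat n → SymMat n := metricProj (nonnegCone n) with hP
  have hPp : ∀ Z p, (P Z).1 p = max (Z.1 p) 0 := fun Z => (metricProj_nonnegCone_spec Z).1
  -- No entry changes sign strictly between `Y` and `X`, so `P` is affine on the segment; its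
  -- one-sided derivative at `Y` then determines the Jacobian in this direction.
  have haff : ∀ t ∈ Set.Icc (0 : ℝ) 1, P (Y + t • (X - Y)) = P Y + t • (P X - P Y) := by
    intro t ht
    ext p
    have e1 : (P Y + t • (P X - P Y)).1 p = max (Y.1 p) 0 + t * (max (X.1 p) 0 - max (Y.1 p) 0) := by
      rw [← hPp, ← hPp]; rfl
    have e2 : (Y + t • (X - Y)).1 p = Y.1 p + t * (X.1 p - Y.1 p) := rfl
    rw [e1, hPp, e2]
    have h1 : Y.1 p + t * (X.1 p - Y.1 p) = (1 - t) * Y.1 p + t * X.1 p := by ring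
    have ht0 := ht.1
    have ht1 : 0 ≤ 1 - t := by linarith [ht.2]
    rw [h1]
    rcases hY p with h | ⟨h, h'⟩ | ⟨h, h'⟩
    · rw [h, max_self, mul_zero, add_zero]
      rcases le_total (Y.1 p) 0 with h' | h'
      · rw [max_eq_right h', max_eq_right (mul_nonpos_of_nonneg_of_nonpos ht1 h')]; ring
      · rw [max_eq_left h', max_eq_left (mul_nonneg ht1 h')]; ring
    · rw [max_eq_left h.le, max_eq_left h'.le, max_eq_left (by positivity)]; ring
    · rw [max_eq_right h.le, max_eq_right h'.le, max_eq_right]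
      · ring
      · nlinarith
  have h1 : HasDerivAt (fun t : ℝ => P (Y + t • (X - Y))) (fderiv ℝ P Y (X - Y)) 0 :=
    hd.hasFDerivAt.hasLineDerivAt (X - Y)
  have h2 : HasDerivAt (fun t : ℝ => P Y + t • (P X - P Y)) (P X - P Y) 0 := by
    simpa using ((hasDerivAt_id (0 : ℝ)).smul_const (P X - P Y)).const_add (P Y)
  have h3 : HasDerivWithinAt (fun t : ℝ => P (Y + t • (X - Y))) (P X - P Y) (Set.Icc 0 1) 0 :=
    h2.hasDerivWithinAt.congr haff (haff 0 (by simp))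
  have h4 := (uniqueDiffOn_Icc_zero_one 0 (by simp)).eq_deriv _ h1.hasDerivWithinAt h3
  rw [← neg_sub X Y, map_neg, h4, neg_sub]

end Nonneg

/-! ### From projections to penalty terms. -/

section AugmentedLagrangian

variable {E : Type*} [NormedAddCommGroup E] [InnerProductSpace ℝ E] {P : E → E}

theorem IsConeProj.continuous (hP : IsConeProj P) : Continuous P :=
  (LipschitzWith.of_dist_le_mul (K := 1) fun x y => by
    simpa [dist_eq_norm] using hP.norm_sub_le x y).continuous

theorem eventually_clarke_estimate (hP : IsConeProj P) {x : E} {C : ℝ}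
    (h : ∀ᶠ y in 𝓝 x, DifferentiableAt ℝ P y →
      ‖P y - P x - fderiv ℝ P y (y - x)‖ ≤ C * ‖y - x‖ ^ 2) :
    ∀ᶠ y in 𝓝 x, ∀ V ∈ clarkeJacobian P y, ‖P y - P x - V (y - x)‖ ≤ C * ‖y - x‖ ^ 2 := by
  obtain ⟨U, hUs, hU, hxU⟩ := mem_nhds_iff.1 h
  filter_upwards [hU.mem_nhds hxU] with y hy V hV
  exact clarkeJacobian_quadratic_estimate hP.continuous hU (fun y hy => hUs hy) hy hV

theorem tendsto_affine (s x : E) (σ : ℝ) :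
    Tendsto (fun y => s - σ • y) (𝓝 x) (𝓝 (s - σ • x)) :=
  tendsto_const_nhds.sub (tendsto_id.const_smul σ)

theorem norm_affine_sub (s x y : E) {σ : ℝ} (hσ : 0 < σ) :
    ‖(s - σ • y) - (s - σ • x)‖ = σ * ‖y - x‖ := by
  rw [sub_sub_sub_cancel_left, ← smul_sub, norm_smul, Real.norm_of_nonneg hσ.le, norm_sub_rev]

theorem inner_add_sub_eq_norm_sq_sub (a b : E) : ⟪a + b, a - b⟫ = ‖a‖ ^ 2 - ‖b‖ ^ 2 := by
  rw [inner_add_left, inner_sub_right, inner_sub_right, real_inner_self_eq_norm_sq,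
    real_inner_self_eq_norm_sq, real_inner_comm a b]
  ring

theorem inner_id_add_smul_add_smul (σ : ℝ) (V₁ V₂ : E →L[ℝ] E) (v w : E) :
    ⟪(ContinuousLinearMap.id ℝ E + σ • V₁ + σ • V₂) v, w⟫ =
      ⟪v, w⟫ + σ * ⟪V₁ v, w⟫ + σ * ⟪V₂ v, w⟫ := by
  simp only [add_apply, smul_apply, ContinuousLinearMap.id_apply, inner_add_left,
    real_inner_smul_left]

theorem penalty_semismooth {σ : ℝ} (hσ : 0 < σ) (s : E) {z : E} (hss : ∃ C, ∀ᶠ y in 𝓝 (s - σ • z),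
    ∀ V ∈ clarkeJacobian P y,
      ‖P y - P (s - σ • z) - V (y - (s - σ • z))‖ ≤ C * ‖y - (s - σ • z)‖ ^ 2) :
    ∃ C, ∀ᶠ x in 𝓝 z, ∀ V ∈ clarkeJacobian P (s - σ • x),
      ‖P (s - σ • x) - P (s - σ • z) + σ • V (x - z)‖ ≤ C * ‖x - z‖ ^ 2 := by
  obtain ⟨C, hC⟩ := hss
  refine ⟨C * σ ^ 2, ?_⟩
  filter_upwards [(tendsto_affine s z σ).eventually hC] with x hx V hV
  have h := hx V hV
  rw [norm_affine_sub s z x hσ] at h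
  have h3 : (s - σ • x) - (s - σ • z) = -(σ • (x - z)) := by rw [smul_sub]; abel
  rw [h3, map_neg, map_smul, sub_neg_eq_add] at h
  calc _ ≤ _ := h
    _ = _ := by ring

variable {σ : ℝ} (hσ : 0 < σ) (hP : IsConeProj P) (s : E)
include hσ hP

theorem IsConeProj.penalty_bounds (x y : E) :
    -⟪P (s - σ • x), y - x⟫ ≤
        1 / (2 * σ) * ‖P (s - σ • y)‖ ^ 2 - 1 / (2 * σ) * ‖P (s - σ • x)‖ ^ 2 ∧
      1 / (2 * σ) * ‖P (s - σ • y)‖ ^ 2 - 1 / (2 * σ) * ‖P (s - σ • x)‖ ^ 2 ≤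
        -⟪P (s - σ • x), y - x⟫ + σ * ‖y - x‖ ^ 2 := by
  have h1 := hP.linearization_le (s - σ • x) (s - σ • y)
  have h2 := hP.le_linearization (s - σ • x) (s - σ • y)
  rw [norm_affine_sub s x y hσ] at h2
  have h3 : (s - σ • y) - (s - σ • x) = -(σ • (y - x)) := by rw [smul_sub]; abel
  rw [h3, inner_neg_right, inner_smul_right] at h1 h2
  have h4 : 1 / (2 * σ) * ‖P (s - σ • y)‖ ^ 2 - 1 / (2 * σ) * ‖P (s - σ • x)‖ ^ 2 =
      (1 / 2 * ‖P (s - σ • y)‖ ^ 2 - 1 / 2 * ‖P (s - σ • x)‖ ^ 2) / σ := by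
    field_simp
  rw [h4, le_div_iff₀ hσ, div_le_iff₀ hσ]
  constructor <;> nlinarith

theorem IsConeProj.penalty_trapezoid {z : E} (htr : ∃ C, ∀ᶠ y in 𝓝 (s - σ • z),
    |⟪P y, s - σ • z⟫ - ⟪P (s - σ • z), y⟫| ≤ C * ‖y - (s - σ • z)‖ ^ 3) :
    ∃ C, ∀ᶠ x in 𝓝 z, |1 / (2 * σ) * ‖P (s - σ • x)‖ ^ 2 - 1 / (2 * σ) * ‖P (s - σ • z)‖ ^ 2 +
      1 / 2 * ⟪P (s - σ • x) + P (s - σ • z), x - z⟫| ≤ C * ‖x - z‖ ^ 3 := by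
  obtain ⟨C, hC⟩ := htr
  refine ⟨1 / (2 * σ) * (C * σ ^ 3), ?_⟩
  filter_upwards [(tendsto_affine s z σ).eventually hC] with x hx
  -- Substituting `‖P y‖² = ⟪P y, y⟫` leaves only the skew difference.
  have h0 : 1 / (2 * σ) * ‖P (s - σ • x)‖ ^ 2 - 1 / (2 * σ) * ‖P (s - σ • z)‖ ^ 2 +
      1 / 2 * ⟪P (s - σ • x) + P (s - σ • z), x - z⟫ =
      1 / (2 * σ) * (⟪P (s - σ • x), s - σ • z⟫ - ⟪P (s - σ • z), s - σ • x⟫) := by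
    rw [hP.norm_sq_eq, hP.norm_sq_eq]
    simp only [inner_add_left, inner_sub_right, inner_smul_right]
    field_simp
    ring
  rw [h0, abs_mul, abs_of_pos (by positivity), mul_assoc]
  refine mul_le_mul_of_nonneg_left ?_ (by positivity)
  rw [norm_affine_sub s z x hσ] at hx
  calc _ ≤ _ := hx
    _ = _ := by ring

end AugmentedLagrangian

/-- The gradient of the augmented Lagrangian. -/
noncomputable def augLagrangianGrad (G : SymMat n) (σ : ℝ) (S Z X : SymMat n) : SymMat n :=
  X - G - metricProj (psdCone n) (S - σ • X) - metricProj (nonnegCone n) (Z - σ • X)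

/-- The generalized Hessians used by the semismooth Newton-CG method. -/
def augLagrangianHess (σ : ℝ) (S Z X : SymMat n) : Set (SymMat n →L[ℝ] SymMat n) :=
  {A | ∃ V₁ ∈ clarkeJacobian (metricProj (psdCone n)) (S - σ • X),
    ∃ V₂ ∈ clarkeJacobian (metricProj (nonnegCone n)) (Z - σ • X),
      A = ContinuousLinearMap.id ℝ (SymMat n) + σ • V₁ + σ • V₂}

theorem augLagrangianHess_symm {S Z : SymMat n} {σ : ℝ} {X : SymMat n} {A : SymMat n →L[ℝ] SymMat n}
    (hA : A ∈ augLagrangianHess σ S Z X) (v w : SymMat n) : ⟪A v, w⟫ = ⟪v, A w⟫ := by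
  obtain ⟨V₁, h₁, V₂, h₂, rfl⟩ := hA
  rw [real_inner_comm _ v, inner_id_add_smul_add_smul, inner_id_add_smul_add_smul,
    real_inner_comm v w, real_inner_comm v (V₁ w), real_inner_comm v (V₂ w), isConeProj_psdCone.clarke_inner_comm h₁, isConeProj_nonnegCone.clarke_inner_comm h₂]

/-! ### Verification of the abstract hypotheses for the augmented Lagrangian. -/

section Bounds

variable {G S Z : SymMat n} {σ : ℝ} (hσ : 0 < σ)
include hσ

theorem augLagrangian_nonneg (X : SymMat n) : 0 ≤ augLagrangian G σ S Z X := by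
  unfold augLagrangian; positivity

/-- The proximal term supplies all the strong convexity; each penalty is convex and adds at most `σ`
to the upper quadratic coefficient. -/
theorem augLagrangian_bounds (X Y : SymMat n) :
    ⟪augLagrangianGrad G σ S Z X, Y - X⟫ + 1 / 2 * ‖Y - X‖ ^ 2 ≤
        augLagrangian G σ S Z Y - augLagrangian G σ S Z X ∧
      augLagrangian G σ S Z Y - augLagrangian G σ S Z X ≤
        ⟪augLagrangianGrad G σ S Z X, Y - X⟫ + (1 / 2 + 2 * σ) * ‖Y - X‖ ^ 2 := by
  have h1 := isConeProj_psdCone.penalty_bounds hσ S X Y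
  have h2 := isConeProj_nonnegCone.penalty_bounds hσ Z X Y
  have h3 : 1 / 2 * ‖Y - G‖ ^ 2 =
      1 / 2 * ‖X - G‖ ^ 2 + ⟪X - G, Y - X⟫ + 1 / 2 * ‖Y - X‖ ^ 2 := by
    have : Y - G = (X - G) + (Y - X) := by abel
    rw [this, norm_add_sq_real]; ring
  simp only [augLagrangian, augLagrangianGrad]
  rw [inner_sub_left, inner_sub_left, h3, mul_add, mul_add]
  constructor <;> linarith [h1.1, h1.2, h2.1, h2.2]

theorem gradient_augLagrangian (X : SymMat n) :
    ∇ (augLagrangian G σ S Z) X = augLagrangianGrad G σ S Z X :=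
  (hasGradientAt_of_abs_le (K := 1 / 2 + 2 * σ) fun Y => by
    have h := augLagrangian_bounds (G := G) (S := S) (Z := Z) hσ X Y
    have : 0 ≤ σ * ‖Y - X‖ ^ 2 := by positivity
    rw [abs_le]
    constructor <;> nlinarith [h.1, h.2, sq_nonneg ‖Y - X‖]).gradient

theorem augLagrangianGrad_lipschitz (X Y : SymMat n) :
    ‖augLagrangianGrad G σ S Z X - augLagrangianGrad G σ S Z Y‖ ≤ (1 + 2 * σ) * ‖X - Y‖ := by
  have h1 := (isConeProj_psdCone.norm_sub_le (S - σ • X) (S - σ • Y)).trans_eq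
    (norm_affine_sub _ _ _ hσ)
  have h2 := (isConeProj_nonnegCone.norm_sub_le (Z - σ • X) (Z - σ • Y)).trans_eq
    (norm_affine_sub _ _ _ hσ)
  have h3 : augLagrangianGrad G σ S Z X - augLagrangianGrad G σ S Z Y = (X - Y) -
      (metricProj (psdCone n) (S - σ • X) - metricProj (psdCone n) (S - σ • Y)) -
      (metricProj (nonnegCone n) (Z - σ • X) - metricProj (nonnegCone n) (Z - σ • Y)) := by
    simp only [augLagrangianGrad]; abel
  rw [h3]
  refine (norm_sub_le _ _).trans ((add_le_add_left (norm_sub_le _ _) _).trans ?_)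
  linarith

theorem augLagrangianHess_coercive {X : SymMat n} {A : SymMat n →L[ℝ] SymMat n}
    (hA : A ∈ augLagrangianHess σ S Z X) (v : SymMat n) : ‖v‖ ^ 2 ≤ ⟪A v, v⟫ := by
  obtain ⟨V₁, h₁, V₂, h₂, rfl⟩ := hA
  rw [inner_id_add_smul_add_smul, real_inner_self_eq_norm_sq]
  have e1 := mul_nonneg hσ.le (isConeProj_psdCone.clarke_inner_nonneg h₁ v)
  have e2 := mul_nonneg hσ.le (isConeProj_nonnegCone.clarke_inner_nonneg h₂ v)
  linarith

theorem augLagrangianHess_bounded {X : SymMat n} {A : SymMat n →L[ℝ] SymMat n}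
    (hA : A ∈ augLagrangianHess σ S Z X) (v : SymMat n) : ‖A v‖ ≤ (1 + 2 * σ) * ‖v‖ := by
  obtain ⟨V₁, h₁, V₂, h₂, rfl⟩ := hA
  simp only [add_apply, smul_apply, ContinuousLinearMap.id_apply]
  have e1 : ‖σ • V₁ v‖ ≤ σ * ‖v‖ := by
    rw [norm_smul, Real.norm_of_nonneg hσ.le]
    exact mul_le_mul_of_nonneg_left
      (by simpa using V₁.le_of_opNorm_le (isConeProj_psdCone.clarke_norm_le h₁) v) hσ.le
  have e2 : ‖σ • V₂ v‖ ≤ σ * ‖v‖ := by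
    rw [norm_smul, Real.norm_of_nonneg hσ.le]
    exact mul_le_mul_of_nonneg_left
      (by simpa using V₂.le_of_opNorm_le (isConeProj_nonnegCone.clarke_norm_le h₂) v) hσ.le
  refine (norm_add₃_le).trans ?_
  linarith

theorem augLagrangianGrad_semismooth (W : SymMat n) : ∃ C, ∀ᶠ X in 𝓝 W,
    ∀ A ∈ augLagrangianHess σ S Z X,
      ‖augLagrangianGrad G σ S Z X - augLagrangianGrad G σ S Z W - A (X - W)‖ ≤
        C * ‖X - W‖ ^ 2 := by
  obtain ⟨C₁, hC₁⟩ := penalty_semismooth hσ S (z := W) (by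
    obtain ⟨C, hC⟩ := psdProj_quadratic_estimate (S - σ • W)
    exact ⟨C, eventually_clarke_estimate isConeProj_psdCone (Eventually.of_forall hC)⟩)
  obtain ⟨C₂, hC₂⟩ := penalty_semismooth hσ Z (z := W) (by
    refine ⟨0, eventually_clarke_estimate isConeProj_nonnegCone ?_⟩
    filter_upwards [nonnegProj_fderiv_eq (Z - σ • W)] with Y hY hd
    rw [hY hd]; simp)
  refine ⟨C₁ + C₂, ?_⟩
  filter_upwards [hC₁, hC₂] with X h₁ h₂
  rintro A ⟨V₁, hV₁, V₂, hV₂, rfl⟩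
  have e : augLagrangianGrad G σ S Z X - augLagrangianGrad G σ S Z W -
      (ContinuousLinearMap.id ℝ (SymMat n) + σ • V₁ + σ • V₂) (X - W) =
      -(metricProj (psdCone n) (S - σ • X) - metricProj (psdCone n) (S - σ • W) +
        σ • V₁ (X - W)) -
      (metricProj (nonnegCone n) (Z - σ • X) - metricProj (nonnegCone n) (Z - σ • W) +
        σ • V₂ (X - W)) := by
    simp only [augLagrangianGrad, add_apply, smul_apply, ContinuousLinearMap.id_apply]
    abel
  rw [e]
  refine (norm_sub_le _ _).trans ?_
  rw [norm_neg, add_mul]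
  exact add_le_add (h₁ V₁ hV₁) (h₂ V₂ hV₂)

theorem augLagrangian_trapezoid (W : SymMat n) : ∃ C, ∀ᶠ X in 𝓝 W,
    |augLagrangian G σ S Z X - augLagrangian G σ S Z W -
      1 / 2 * ⟪augLagrangianGrad G σ S Z X + augLagrangianGrad G σ S Z W, X - W⟫| ≤
        C * ‖X - W‖ ^ 3 := by
  obtain ⟨C₁, hC₁⟩ := isConeProj_psdCone.penalty_trapezoid hσ S (z := W) (by
    obtain ⟨C, hC⟩ := psdProj_trapezoid (S - σ • W)
    exact ⟨C, Eventually.of_forall hC⟩)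
  obtain ⟨C₂, hC₂⟩ := isConeProj_nonnegCone.penalty_trapezoid hσ Z (z := W) (by
    refine ⟨0, ?_⟩
    filter_upwards [nonnegProj_trapezoid (Z - σ • W)] with Y hY
    rw [hY]; simp)
  refine ⟨C₁ + C₂, ?_⟩
  filter_upwards [hC₁, hC₂] with X h₁ h₂
  have h3 : 1 / 2 * ‖X - G‖ ^ 2 - 1 / 2 * ‖W - G‖ ^ 2 =
      1 / 2 * ⟪(X - G) + (W - G), X - W⟫ := by
    have : X - W = (X - G) - (W - G) := by abel
    rw [this, inner_add_sub_eq_norm_sq_sub]; ring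
  have e : augLagrangianGrad G σ S Z X + augLagrangianGrad G σ S Z W =
      ((X - G) + (W - G)) -
      (metricProj (psdCone n) (S - σ • X) + metricProj (psdCone n) (S - σ • W)) -
      (metricProj (nonnegCone n) (Z - σ • X) + metricProj (nonnegCone n) (Z - σ • W)) := by
    simp only [augLagrangianGrad]; abel
  rw [e, inner_sub_left, inner_sub_left, add_mul]
  refine le_trans (le_of_eq ?_) ((abs_add_le _ _).trans (add_le_add h₁ h₂))
  simp only [augLagrangian]
  congr 1
  linarith

theorem IsSNCGStep.isInexactNewtonStep {μ η τ δ : ℝ} {X X' : SymMat n}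
    (h : IsSNCGStep G S Z σ μ η τ δ X X') :
    IsInexactNewtonStep (augLagrangian G σ S Z) (augLagrangianGrad G σ S Z)
      (augLagrangianHess σ S Z) μ η τ δ X X' := by
  obtain ⟨V₁, h₁, V₂, h₂, D, hD, m, hm, hX'⟩ := h
  rw [gradient_augLagrangian hσ] at hD hm
  have hA : ContinuousLinearMap.id ℝ (SymMat n) + σ • V₁ + σ • V₂ ∈ augLagrangianHess σ S Z X :=
    ⟨V₁, h₁, V₂, h₂, rfl⟩
  refine ⟨_, hA, D, hD.inner_eq (augLagrangianHess_symm hA) (augLagrangianHess_coercive hσ hA), ?_,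
    m, hm, hX'⟩
  simpa using hD.norm_le

end Bounds

end DNN

theorem mainTheorem8 (n : ℕ) (G S Z : DNN.SymMat n) (σ : ℝ) (hσ : 0 < σ)
    (μ η τ δ : ℝ) (hμ : μ ∈ Set.Ioo (0 : ℝ) (1 / 2)) (hη : η ∈ Set.Ioo (0 : ℝ) 1)
    (hτ : τ ∈ Set.Ioc (0 : ℝ) 1) (hδ : δ ∈ Set.Ioo (0 : ℝ) 1)
    (X : ℕ → DNN.SymMat n) (hX : DNN.IsSNCGSequence G S Z σ μ η τ δ X) :
    ∃ Xbar : DNN.SymMat n,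
      (∀ Y, DNN.augLagrangian G σ S Z Xbar ≤ DNN.augLagrangian G σ S Z Y) ∧
      (∀ Y, (∀ W, DNN.augLagrangian G σ S Z Y ≤ DNN.augLagrangian G σ S Z W) → Y = Xbar) ∧
      Tendsto X atTop (𝓝 Xbar) ∧
      (fun j => ‖X (j + 1) - Xbar‖) =O[atTop] (fun j => ‖X j - Xbar‖ ^ (1 + τ)) :=
  DNN.inexactNewton_converges hμ hη hτ hδ (K := 1 / 2 + 2 * σ) (L := 1 + 2 * σ)
    (by positivity) (by positivity) (DNN.augLagrangian_nonneg hσ)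
    (fun A B => (DNN.augLagrangian_bounds hσ A B).1)
    (fun A B => (DNN.augLagrangian_bounds hσ A B).2)
    (DNN.augLagrangianGrad_lipschitz hσ)
    (fun _ _ hA => DNN.augLagrangianHess_coercive hσ hA)
    (fun _ _ hA => DNN.augLagrangianHess_bounded hσ hA)
    (DNN.augLagrangianGrad_semismooth hσ) (DNN.augLagrangian_trapezoid hσ)
    (fun j => (hX j).isInexactNewtonStep hσ)
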